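/- Let $\mathbf{Cat}$ be the 2-category of small categories, functors and natural transformations, with the monoidal structure $(\times,1)$; write $\alpha_{A,B,C}:(A\times B)\times C\to A\times(B\times C)$, $\lambda_A:1\times A\to A$, $\rho_A:A\times 1\to A$ for its strictly natural associator and unitors (the structural modifications of this monoidal bicategory are identities). In component equations below the compositors and unitors of pseudofunctors are not displayed, and neither are identities. **Definitions.** A *left strength* for a pseudofunctor $T:\mathbf{Cat}\to\mathbf{Cat}$ consists of a pseudonatural transformation $t_{A,B}:A\times TB\to T(A\times B)$ (pseudonatural in $A$ and $B$) with 2-cells $\bar t_{f,g}: t(fa,(Tg)w)\cong T(f\times g)(t(a,w))$, and invertible modifications $x,y$ with components $$x_{i,w}:T\lambda\,(t(i,w))\to w,\qquad y_{a,b,w}:t(a,t(b,w))\to T\alpha\,(t((a,b),w))$$ for $i\in 1$, $a\in A$, $b\in B$ and $w$ in $TA$, respectively $TC$, satisfying the three axioms $$\bar t_{\rho,1}\circ t(a,x_{i,w})\circ \bar t_{1,\lambda}^{-1}=T(1\times\lambda)(y_{a,i,w}),\qquad \bar t_{\lambda,1}\circ x_{i,t(a,w)}=T\lambda\,(y_{i,a,w}),$$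 $$T\alpha\,(y_{(a,b),c,w})\circ y_{a,b,t(c,w)}=T(1\times\alpha)\big(T\alpha\,(\bar t_{\alpha,1})\circ y_{a,(b,c),w}\big)\circ\bar t_{1,\alpha}\circ t(a,y_{b,c,w}).$$ A pseudomonad $(T,\eta,\mu,m,n,p)$ on a bicategory is a pseudofunctor $T$ with pseudonatural $\eta:\mathrm{id}\Rightarrow T$, $\mu:T^2\Rightarrow T$ and invertible modifications $m:\mu\circ T\mu\to\mu\circ\mu_T$, $n:\mu\circ\eta_T\to\mathrm{id}$, $p:\mu\circ T\eta\to\mathrm{id}$, satisfying the two usual coherence axioms (the one for $T^4\Rightarrow T$ relating $m$ to itself, and the unit one, $\mu_A\circ T n_A=(\mu_A\circ p_{TA})\cdot(m_A\circ T\eta_{TA})$, both being 2-cells $\mu_A\circ T\mu_A\circ T\eta_{TA}\to\mu_A$, with $\cdot$ vertical composition). A *left strength* for a pseudomonad on $(\mathbf{Cat},\times,1)$ is a left strength $(t,x,y)$ for $T$ together with invertible modifications with components $$w_{a,W}:\mu(Tt\,(t(a,W)))\to t(a,\mu W),\qquad z_{a,b}:t(a,\eta b)\to\eta(a,b)$$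 for $W\in T^2B$, satisfying seven axioms (where $\bar\eta_f:\eta\circ f\cong Tf\circ\eta$ and $\bar\mu_f:\mu\circ T^2f\cong Tf\circ\mu$ are the pseudonaturality 2-cells): 1. $t(a,n_v)\circ w_{a,\eta v}=n_{t(a,v)}\circ\mu(\bar\eta_t^{-1})\circ\mu(Tt(z_{a,v}))$; 2. $t(a,p_v)\circ w_{a,(T\eta) v}=p_{t(a,v)}\circ\mu((Tz)_{t(a,v)})\circ\mu(Tt(\bar t_{1,\eta}))$; 3. $w_{a,\mu V}\circ\mu(Tt(w_{a,V}))\circ\mu(\bar\mu_t)\circ m=t(a,m_V)\circ w_{a,(T\mu) V}\circ\mu(Tt(\bar t_{1,\mu}^{-1}))\circ\mu((Tw)_{t(a,V)})$ for $V\in T^3B$; 4. $\bar\eta_\lambda^{-1}\circ T\lambda(z_{i,a})=x_{i,\eta a}$; 5. $\mu(x_{i,W})\circ\mu((Tx)_{t(i,W)})=x_{i,\mu W}\circ T\lambda(w_{i,W})\circ\bar\mu_\lambda$; 6. $T\alpha(w_{(a,b),W})\circ\bar\mu_\alpha\circ\mu((Ty)_{t((a,b),W)})\circ\mu\big(Tt(T(1\times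 t)(y_{a,b,W})\circ\bar t_{1,t})\big)=y_{a,b,\mu W}\circ t(a,w_{b,W})\circ w_{a,Tt(t(b,W))}$; 7. $z_{a,(b,c)}\circ t(a,z_{b,c})=\bar\eta_\alpha^{-1}\circ T\alpha(z_{(a,b),c})\circ y_{a,b,\eta c}$. For $a\in A$ let $\langle a,-\rangle:B\to A\times B$ be the functor $b\mapsto(a,b)$, and for $k:a\to a'$ in $A$ let $\langle k,-\rangle:\langle a,-\rangle\Rightarrow\langle a',-\rangle$ be the natural transformation with components $(k,\mathrm{id}_b)$. **Proposition.** (1) Every pseudofunctor $T:\mathbf{Cat}\to\mathbf{Cat}$ has a canonical left strength: there is a left strength $(t,x,y)$ with $$t(a,w)=T(\langle a,-\rangle)(w),\qquad t(k,l)=T(\langle a',-\rangle)(l)\circ T(\langle k,-\rangle)_w\quad(k:a\to a',\ l:w\to w'),$$ whose pseudonaturality 2-cells are the compositor isomorphisms $$T\langle fa,-\rangle(Tg\,w)\cong T(\langle fa,-\rangle\circ g)(w)=T((f\times g)\circ\langle a,-\rangle)(w)\cong T(f\times g)(T\langle a,-\rangle w),$$ where $x_{i,w}$ is the compositor and unitor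 isomorphism $T\lambda(T\langle i,-\rangle w)\cong T(\mathrm{id})(w)\cong w$, and where $y_{a,b,w}$ is the compositor isomorphism $T\langle a,-\rangle(T\langle b,-\rangle w)\cong T(\alpha\circ\langle(a,b),-\rangle)(w)\cong T\alpha(T\langle(a,b),-\rangle w)$. (2) Every pseudomonad on $\mathbf{Cat}$ has a canonical left strength: there is a left strength $(t,x,y,w,z)$ for it whose part $(t,x,y)$ is as in (1), where $w_{a,W}$ is the composite of the compositor $\mu\big(Tt(T\langle a,-\rangle W)\big)\cong\mu\big(T(T\langle a,-\rangle)W\big)$ (using $t\circ\langle a,-\rangle=T\langle a,-\rangle$) with the pseudonaturality 2-cell $\mu\big(T(T\langle a,-\rangle)W\big)\cong T\langle a,-\rangle(\mu W)$ of $\mu$, and where $z_{a,b}:T\langle a,-\rangle(\eta b)\cong\eta(a,b)$ is the inverse of the pseudonaturality 2-cell of $\eta$ at $\langle a,-\rangle$. -/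

import Mathlib

open CategoryTheory Bicategory

universe v u w₁ v₁ u₁

/-! ## Pseudomonads on a bicategory -/

/-- The image under a pseudofunctor of an invertible 2-cell filling a square, conjugated by the
compositors. -/
def Pseudo.mapSquare {B : Type u₁} [Bicategory.{w₁, v₁} B] (T : B ⥤ᵖ B) {a b b' c : B}
    {f : a ⟶ b} {g : b ⟶ c} {h : a ⟶ b'} {k : b' ⟶ c} (σ : f ≫ g ≅ h ≫ k) :
    T.map f ≫ T.map g ≅ T.map h ≫ T.map k :=
  (T.mapComp f g).symm ≪≫ T.map₂Iso σ ≪≫ T.mapComp h k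

/-- A pseudofunctor `T` with pseudonatural transformations `η : id ⟶ T` and `μ : T ∘ T ⟶ T`. -/
structure PseudomonadData (B : Type u₁) [Bicategory.{w₁, v₁} B] where
  /-- The underlying pseudofunctor. -/
  T : B ⥤ᵖ B
  /-- The unit. -/
  η : Pseudofunctor.StrongTrans (Pseudofunctor.id B) T
  /-- The multiplication. -/
  μ : Pseudofunctor.StrongTrans (T.comp T) T

namespace PseudomonadData

variable {B : Type u₁} [Bicategory.{w₁, v₁} B] (M : PseudomonadData B)

/-- The 1-cell `η_A : A ⟶ T A`. -/
def eta (A : B) : A ⟶ M.T.obj A := M.η.app A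

/-- The 1-cell `μ_A : T (T A) ⟶ T A`. -/
def mu (A : B) : M.T.obj (M.T.obj A) ⟶ M.T.obj A := M.μ.app A

/-- The invertible 2-cell witnessing naturality of `η` at `f`. -/
def etaNat {A A' : B} (f : A ⟶ A') : f ≫ M.eta A' ≅ M.eta A ≫ M.T.map f := M.η.naturality f

/-- The invertible 2-cell witnessing naturality of `μ` at `f`. -/
def muNat {A A' : B} (f : A ⟶ A') :
    M.T.map (M.T.map f) ≫ M.mu A' ≅ M.mu A ≫ M.T.map f := M.μ.naturality f

end PseudomonadData

/-- A pseudomonad on a bicategory: a pseudofunctor `T` with a unit `η`, a multiplication `μ` and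
invertible modifications `m : μ ∘ T μ ⟶ μ ∘ μ T`, `n : μ ∘ η T ⟶ id`, `p : μ ∘ T η ⟶ id`,
subject to two coherence axioms. -/
structure Pseudomonad (B : Type u₁) [Bicategory.{w₁, v₁} B] extends PseudomonadData B where
  m (A : B) : T.map (toPseudomonadData.mu A) ≫ toPseudomonadData.mu A ≅
    toPseudomonadData.mu (T.obj A) ≫ toPseudomonadData.mu A
  n (A : B) : toPseudomonadData.eta (T.obj A) ≫ toPseudomonadData.mu A ≅ 𝟙 (T.obj A)
  p (A : B) : T.map (toPseudomonadData.eta A) ≫ toPseudomonadData.mu A ≅ 𝟙 (T.obj A)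
  /-- `m` is a modification. -/
  m_naturality {A A' : B} (f : A ⟶ A') :
    T.map (T.map (T.map f)) ◁ (m A').hom ≫ (α_ _ _ _).inv ≫
        (toPseudomonadData.muNat (T.map f)).hom ▷ toPseudomonadData.mu A' ≫ (α_ _ _ _).hom ≫
        toPseudomonadData.mu (T.obj A) ◁ (toPseudomonadData.muNat f).hom ≫ (α_ _ _ _).inv =
      (α_ _ _ _).inv ≫
        (Pseudo.mapSquare T (toPseudomonadData.muNat f)).hom ▷ toPseudomonadData.mu A' ≫
        (α_ _ _ _).hom ≫
        T.map (toPseudomonadData.mu A) ◁ (toPseudomonadData.muNat f).hom ≫ (α_ _ _ _).inv ≫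
        (m A).hom ▷ T.map f
  /-- `n` is a modification. -/
  n_naturality {A A' : B} (f : A ⟶ A') :
    T.map f ◁ (n A').hom ≫ (ρ_ _).hom ≫ (λ_ _).inv =
      (α_ _ _ _).inv ≫
        (toPseudomonadData.etaNat (T.map f)).hom ▷ toPseudomonadData.mu A' ≫ (α_ _ _ _).hom ≫
        toPseudomonadData.eta (T.obj A) ◁ (toPseudomonadData.muNat f).hom ≫ (α_ _ _ _).inv ≫
        (n A).hom ▷ T.map f
  /-- `p` is a modification. -/
  p_naturality {A A' : B} (f : A ⟶ A') :
    T.map f ◁ (p A').hom ≫ (ρ_ _).hom ≫ (λ_ _).inv =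
      (α_ _ _ _).inv ≫
        (Pseudo.mapSquare T (toPseudomonadData.etaNat f)).hom ▷ toPseudomonadData.mu A' ≫
        (α_ _ _ _).hom ≫
        T.map (toPseudomonadData.eta A) ◁ (toPseudomonadData.muNat f).hom ≫ (α_ _ _ _).inv ≫
        (p A).hom ▷ T.map f
  /-- Coherence of `m` with itself, between the 1-cells `T (T (T (T A))) ⟶ T A`. -/
  assoc_coherence (A : B) :
    (α_ _ _ _).inv ≫ (Pseudo.mapSquare T (m A)).hom ▷ toPseudomonadData.mu A ≫
        (α_ _ _ _).hom ≫ T.map (toPseudomonadData.mu (T.obj A)) ◁ (m A).hom ≫ (α_ _ _ _).inv ≫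
        (m (T.obj A)).hom ▷ toPseudomonadData.mu A ≫ (α_ _ _ _).hom =
      T.map (T.map (toPseudomonadData.mu A)) ◁ (m A).hom ≫ (α_ _ _ _).inv ≫
        (toPseudomonadData.muNat (toPseudomonadData.mu A)).hom ▷ toPseudomonadData.mu A ≫
        (α_ _ _ _).hom ≫ toPseudomonadData.mu (T.obj (T.obj A)) ◁ (m A).hom
  /-- Coherence of `m` with `n` and `p`, between the 1-cells `T (T A) ⟶ T A`. -/
  unit_coherence (A : B) :
    ((T.mapComp _ _).inv ≫ T.map₂ (n A).hom ≫ (T.mapId _).hom) ▷ toPseudomonadData.mu A =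
      (α_ _ _ _).hom ≫ T.map (toPseudomonadData.eta (T.obj A)) ◁ (m A).hom ≫
        (α_ _ _ _).inv ≫ (p (T.obj A)).hom ▷ toPseudomonadData.mu A

/-! ## The monoidal bicategory `(Cat, ×, 1)`

The product is a strict 2-functor, the associator and unitors are strictly 2-natural
isomorphisms, and the diagrams that the structural modifications of a monoidal bicategory fill
commute on the nose (see the `rfl` lemmas below), so those modifications are identities. -/

namespace CatProd

/-- The unit: the category with one object and one morphism. -/
abbrev one : Cat.{v, u} := Cat.chosenTerminal

/-- The tensor product of objects. -/
abbrev tens (A B : Cat.{v, u}) : Cat.{v, u} := Cat.of (A × B)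

/-- The tensor product of 1-cells. -/
def tensHom {A A' B B' : Cat.{v, u}} (f : A ⟶ A') (g : B ⟶ B') : tens A B ⟶ tens A' B' :=
  (f.toFunctor.prod g.toFunctor).toCatHom

/-- The tensor product of 2-cells. -/
def tensHom₂ {A A' B B' : Cat.{v, u}} {f f' : A ⟶ A'} {g g' : B ⟶ B'} (σ : f ⟶ f')
    (τ : g ⟶ g') : tensHom f g ⟶ tensHom f' g' :=
  (NatTrans.prod σ.toNatTrans τ.toNatTrans).toCatHom₂

/-- The product pseudofunctor `Cat × Cat ⥤ᵖ Cat`; its compositors and unitors are identities. -/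
def prodPseudofunctor : (Cat.{v, u} × Cat.{v, u}) ⥤ᵖ Cat.{v, u} where
  obj X := tens X.1 X.2
  map f := tensHom f.1 f.2
  map₂ σ := tensHom₂ σ.1 σ.2
  map₂_id _ := rfl
  map₂_comp _ _ := rfl
  mapId X := Iso.refl (𝟙 (tens X.1 X.2))
  mapComp f g := Iso.refl (tensHom f.1 f.2 ≫ tensHom g.1 g.2)
  map₂_whisker_left _ _ _ _ := ((Category.id_comp _).trans (Category.comp_id _)).symm
  map₂_whisker_right _ _ := ((Category.id_comp _).trans (Category.comp_id _)).symm
  map₂_associator f g h := by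
    ext x
    refine Prod.ext ?_ ?_
    · change 𝟙 _ = 𝟙 _ ≫ h.1.toFunctor.map (𝟙 _) ≫ 𝟙 _ ≫ 𝟙 _ ≫ 𝟙 _
      simp
    · change 𝟙 _ = 𝟙 _ ≫ h.2.toFunctor.map (𝟙 _) ≫ 𝟙 _ ≫ 𝟙 _ ≫ 𝟙 _
      simp
  map₂_left_unitor f := by
    ext x
    refine Prod.ext ?_ ?_
    · change 𝟙 _ = 𝟙 _ ≫ f.1.toFunctor.map (𝟙 _) ≫ 𝟙 _
      simp
    · change 𝟙 _ = 𝟙 _ ≫ f.2.toFunctor.map (𝟙 _) ≫ 𝟙 _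
      simp
  map₂_right_unitor f := by
    ext x
    refine Prod.ext ?_ ?_
    · change 𝟙 _ = 𝟙 _ ≫ 𝟙 _ ≫ 𝟙 _
      simp
    · change 𝟙 _ = 𝟙 _ ≫ 𝟙 _ ≫ 𝟙 _
      simp

/-- The pseudofunctor `id × T : Cat × Cat ⥤ᵖ Cat × Cat`. -/
def idProd (T : Cat.{v, u} ⥤ᵖ Cat.{v, u}) :
    (Cat.{v, u} × Cat.{v, u}) ⥤ᵖ (Cat.{v, u} × Cat.{v, u}) where
  obj X := (X.1, T.obj X.2)
  map f := (f.1, T.map f.2)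
  map₂ σ := (σ.1, T.map₂ σ.2)
  map₂_id _ := Prod.ext rfl (T.map₂_id _)
  map₂_comp _ _ := Prod.ext rfl (T.map₂_comp _ _)
  mapId X := Iso.prod (Iso.refl _) (T.mapId X.2)
  mapComp f g := Iso.prod (Iso.refl _) (T.mapComp f.2 g.2)
  map₂_whisker_left f g h σ := by
    refine Prod.ext ?_ (T.map₂_whisker_left _ _)
    simp
  map₂_whisker_right σ h := by
    refine Prod.ext ?_ (T.map₂_whisker_right _ _)
    simp
  map₂_associator f g h := by
    refine Prod.ext ?_ (T.map₂_associator _ _ _)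
    simp
  map₂_left_unitor f := by
    refine Prod.ext ?_ (T.map₂_left_unitor _)
    simp
  map₂_right_unitor f := by
    refine Prod.ext ?_ (T.map₂_right_unitor _)
    simp

/-- The associator `((a, b), c) ↦ (a, (b, c))`. -/
def assocHom (A B C : Cat.{v, u}) : tens (tens A B) C ⟶ tens A (tens B C) :=
  (Functor.prod' (CategoryTheory.Prod.fst (A × B) C ⋙ CategoryTheory.Prod.fst A B)
    (Functor.prod' (CategoryTheory.Prod.fst (A × B) C ⋙ CategoryTheory.Prod.snd A B) (CategoryTheory.Prod.snd (A × B) C))).toCatHom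

/-- The left unitor `(i, a) ↦ a`. -/
def lam (A : Cat.{v, u}) : tens one A ⟶ A := (CategoryTheory.Prod.snd one A).toCatHom

/-- The right unitor `(a, i) ↦ a`. -/
def rho (A : Cat.{v, u}) : tens A one ⟶ A := (CategoryTheory.Prod.fst A one).toCatHom

theorem assoc_natural {A A' B B' C C' : Cat.{v, u}} (f : A ⟶ A') (g : B ⟶ B') (h : C ⟶ C') :
    tensHom (tensHom f g) h ≫ assocHom A' B' C' = assocHom A B C ≫ tensHom f (tensHom g h) := rfl

theorem lam_natural {A A' : Cat.{v, u}} (f : A ⟶ A') :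
    tensHom (𝟙 one) f ≫ lam A' = lam A ≫ f := rfl

theorem rho_natural {A A' : Cat.{v, u}} (f : A ⟶ A') :
    tensHom f (𝟙 one) ≫ rho A' = rho A ≫ f := rfl

theorem pentagon (A B C D : Cat.{v, u}) :
    tensHom (assocHom A B C) (𝟙 D) ≫ assocHom A (tens B C) D ≫ tensHom (𝟙 A) (assocHom B C D) =
      assocHom (tens A B) C D ≫ assocHom A B (tens C D) := rfl

theorem triangle (A B : Cat.{v, u}) :
    assocHom A one B ≫ tensHom (𝟙 A) (lam B) = tensHom (rho A) (𝟙 B) := rfl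

theorem triangle_left (A B : Cat.{v, u}) :
    tensHom (lam A) (𝟙 B) = assocHom one A B ≫ lam (tens A B) := rfl

theorem triangle_right (A B : Cat.{v, u}) :
    rho (tens A B) = assocHom A B one ≫ tensHom (𝟙 A) (rho B) := rfl

/-! ### Components of 1-cells and 2-cells of `Cat` -/

/-- The action of a functor on an object. -/
abbrev ob {C D : Cat.{v, u}} (F : C ⟶ D) (c : C) : D := F.toFunctor.obj c

/-- The action of a functor on a morphism. -/
abbrev mp {C D : Cat.{v, u}} (F : C ⟶ D) {c c' : C} (k : c ⟶ c') : ob F c ⟶ ob F c' :=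
  F.toFunctor.map k

/-- The component at `c` of a natural isomorphism. -/
def cell {C D : Cat.{v, u}} {F G : C ⟶ D} (σ : F ≅ G) (c : C) : ob F c ≅ ob G c :=
  (Cat.Hom.toNatIso σ).app c

section

variable (T : Cat.{v, u} ⥤ᵖ Cat.{v, u})

/-- The component at `w` of the compositor `T g ∘ T f ≅ T h`, where `h = g ∘ f`. -/
def compCell {A B C : Cat.{v, u}} (f : A ⟶ B) (g : B ⟶ C) (h : A ⟶ C) (e : f ≫ g = h)
    (w : T.obj A) : ob (T.map g) (ob (T.map f) w) ≅ ob (T.map h) w :=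
  (cell (T.mapComp' f g h e) w).symm

/-- The component at `w` of the unitor `T (id) ≅ id`. -/
def idCell (A : Cat.{v, u}) (w : T.obj A) : ob (T.map (𝟙 A)) w ≅ w :=
  cell (T.mapId A) w

/-- The component at `w` of the comparison `T g ∘ T f ≅ T k ∘ T h`, where `g ∘ f = k ∘ h`. -/
def sqCell {A B B' C : Cat.{v, u}} (f : A ⟶ B) (g : B ⟶ C) (h : A ⟶ B') (k : B' ⟶ C)
    (e : f ≫ g = h ≫ k) (w : T.obj A) :
    ob (T.map g) (ob (T.map f) w) ≅ ob (T.map k) (ob (T.map h) w) :=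
  compCell T f g (h ≫ k) e w ≪≫ (compCell T h k (h ≫ k) rfl w).symm

end

/-! ## Strengths for pseudofunctors on `(Cat, ×, 1)` -/

/-- Pseudonatural transformations with components `A × T B ⟶ T (A × B)`, pseudonatural in
`A` and `B`. -/
abbrev StrengthTrans (T : Cat.{v, u} ⥤ᵖ Cat.{v, u}) :=
  Pseudofunctor.StrongTrans ((idProd T).comp prodPseudofunctor) (prodPseudofunctor.comp T)

/-- The 1-cell `t_{A, B} : A × T B ⟶ T (A × B)`. -/
def StrengthTrans.st {T : Cat.{v, u} ⥤ᵖ Cat.{v, u}} (t : StrengthTrans T) (A B : Cat.{v, u}) :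
    tens A (T.obj B) ⟶ T.obj (tens A B) :=
  Pseudofunctor.StrongTrans.app t (A, B)

/-- The 2-cell witnessing naturality of `t` at `(f, g)`. -/
def StrengthTrans.stNat {T : Cat.{v, u} ⥤ᵖ Cat.{v, u}} (t : StrengthTrans T)
    {A A' B B' : Cat.{v, u}} (f : A ⟶ A') (g : B ⟶ B') :
    tensHom f (T.map g) ≫ StrengthTrans.st t A' B' ≅
      StrengthTrans.st t A B ≫ T.map (tensHom f g) :=
  Pseudofunctor.StrongTrans.naturality t (a := (A, B)) (b := (A', B')) (f, g)

/-- The data of a left strength: a pseudonatural transformation `t` and families of invertible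
2-cells `x` and `y`. -/
structure StrengthData (T : Cat.{v, u} ⥤ᵖ Cat.{v, u}) where
  t : StrengthTrans T
  x (A : Cat.{v, u}) : StrengthTrans.st t one A ≫ T.map (lam A) ≅ lam (T.obj A)
  y (A B C : Cat.{v, u}) :
    assocHom A B (T.obj C) ≫ tensHom (𝟙 A) (StrengthTrans.st t B C) ≫
        StrengthTrans.st t A (tens B C) ≅
      StrengthTrans.st t (tens A B) C ≫ T.map (assocHom A B C)

namespace StrengthData

variable {T : Cat.{v, u} ⥤ᵖ Cat.{v, u}} (s : StrengthData T)

/-- The 1-cell `t_{A, B}`. -/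
def st (A B : Cat.{v, u}) : tens A (T.obj B) ⟶ T.obj (tens A B) := StrengthTrans.st s.t A B

/-- The object `t (a, w)`. -/
def tob {A B : Cat.{v, u}} (a : A) (w : T.obj B) : T.obj (tens A B) := ob (s.st A B) (a, w)

/-- The morphism `t (k, l)`. -/
def tmp {A B : Cat.{v, u}} {a a' : A} {w w' : T.obj B} (k : a ⟶ a') (l : w ⟶ w') :
    s.tob a w ⟶ s.tob a' w' :=
  mp (s.st A B) (c := (a, w)) (c' := (a', w')) (k, l)

/-- The 2-cell witnessing naturality of `t` at `(f, g)`. -/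
def stNat {A A' B B' : Cat.{v, u}} (f : A ⟶ A') (g : B ⟶ B') :
    tensHom f (T.map g) ≫ s.st A' B' ≅ s.st A B ≫ T.map (tensHom f g) :=
  StrengthTrans.stNat s.t f g

/-- The component of `stNat f g` at `(a, w)`. -/
def tnat {A A' B B' : Cat.{v, u}} (f : A ⟶ A') (g : B ⟶ B') (a : A) (w : T.obj B) :
    s.tob (ob f a) (ob (T.map g) w) ≅ ob (T.map (tensHom f g)) (s.tob a w) :=
  cell (s.stNat f g) (a, w)

/-- The component of `t` at a 1-cell `f × id`, with `T (id)` replaced by `id`. -/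
def tnatLeft {A A' : Cat.{v, u}} (f : A ⟶ A') (B : Cat.{v, u}) (a : A) (w : T.obj B) :
    s.tob (ob f a) w ⟶ ob (T.map (tensHom f (𝟙 B))) (s.tob a w) :=
  s.tmp (𝟙 (ob f a)) (idCell T B w).inv ≫ (s.tnat f (𝟙 B) a w).hom

/-- The component of `x` at `(i, w)`. -/
def xc (A : Cat.{v, u}) (i : one.{v, u}) (w : T.obj A) :
    ob (T.map (lam A)) (s.tob i w) ≅ w :=
  cell (s.x A) (i, w)

/-- The component of `y` at `((a, b), w)`. -/
def yc {A B : Cat.{v, u}} (C : Cat.{v, u}) (a : A) (b : B) (w : T.obj C) :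
    s.tob a (s.tob b w) ≅ ob (T.map (assocHom A B C)) (s.tob (A := tens A B) (a, b) w) :=
  cell (s.y A B C) ((a, b), w)

end StrengthData

/-- A left strength for a pseudofunctor `T` on `(Cat, ×, 1)`: the families `x` and `y` are
modifications, and they are compatible with the structural modifications of the monoidal
bicategory. Each equality of pasting diagrams is stated at the objects of the source category. -/
structure LeftStrength (T : Cat.{v, u} ⥤ᵖ Cat.{v, u}) extends StrengthData T where
  /-- `x` is a modification. -/
  x_naturality {A A' : Cat.{v, u}} (f : A ⟶ A') (i : one.{v, u}) (w : T.obj A) :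
    (toStrengthData.xc A' i (ob (T.map f) w)).hom =
      mp (T.map (lam A')) (toStrengthData.tnat (𝟙 one) f i w).hom ≫
        (sqCell T (tensHom (𝟙 one) f) (lam A') (lam A) f rfl (toStrengthData.tob i w)).hom ≫
        mp (T.map f) (toStrengthData.xc A i w).hom
  /-- `y` is a modification. -/
  y_naturality {A A' B B' C C' : Cat.{v, u}} (f : A ⟶ A') (g : B ⟶ B') (h : C ⟶ C')
      (a : A) (b : B) (w : T.obj C) :
    (toStrengthData.yc C' (ob f a) (ob g b) (ob (T.map h) w)).hom ≫
        mp (T.map (assocHom A' B' C'))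
          (toStrengthData.tnat (A := tens A B) (tensHom f g) h (a, b) w).hom ≫
        (sqCell T (tensHom (tensHom f g) h) (assocHom A' B' C') (assocHom A B C)
          (tensHom f (tensHom g h)) rfl (toStrengthData.tob (A := tens A B) (a, b) w)).hom =
      toStrengthData.tmp (𝟙 (ob f a)) (toStrengthData.tnat g h b w).hom ≫
        (toStrengthData.tnat f (tensHom g h) a (toStrengthData.tob b w)).hom ≫
        mp (T.map (tensHom f (tensHom g h))) (toStrengthData.yc C a b w).hom
  /-- Compatibility with the middle unit modification, on `(A × 1) × T B`. -/
  middle_unit {A B : Cat.{v, u}} (a : A) (i : one.{v, u}) (w : T.obj B) :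
    (toStrengthData.tnat (𝟙 A) (lam B) a (toStrengthData.tob i w)).inv ≫
        toStrengthData.tmp (𝟙 a) (toStrengthData.xc B i w).hom ≫
        toStrengthData.tnatLeft (A := tens A one) (rho A) B (a, i) w =
      mp (T.map (tensHom (𝟙 A) (lam B))) (toStrengthData.yc B a i w).hom ≫
        (compCell T (assocHom A one B) (tensHom (𝟙 A) (lam B)) (tensHom (rho A) (𝟙 B)) rfl
          (toStrengthData.tob (A := tens A one) (a, i) w)).hom
  /-- Compatibility with the left unit modification, on `(1 × A) × T B`. -/
  left_unit {A B : Cat.{v, u}} (i : one.{v, u}) (a : A) (w : T.obj B) :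
    (toStrengthData.xc (tens A B) i (toStrengthData.tob a w)).hom ≫
        toStrengthData.tnatLeft (A := tens one A) (lam A) B (i, a) w =
      mp (T.map (lam (tens A B))) (toStrengthData.yc B i a w).hom ≫
        (compCell T (assocHom one A B) (lam (tens A B)) (tensHom (lam A) (𝟙 B)) rfl
          (toStrengthData.tob (A := tens one A) (i, a) w)).hom
  /-- Compatibility with the pentagon modification, on `((A × B) × C) × T D`. -/
  pentagon {A B C D : Cat.{v, u}} (a : A) (b : B) (c : C) (w : T.obj D) :
    (toStrengthData.yc (tens C D) a b (toStrengthData.tob c w)).hom ≫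
        mp (T.map (assocHom A B (tens C D)))
          (toStrengthData.yc (A := tens A B) D (a, b) c w).hom =
      toStrengthData.tmp (𝟙 a) (toStrengthData.yc D b c w).hom ≫
        (toStrengthData.tnat (𝟙 A) (assocHom B C D) a
          (toStrengthData.tob (A := tens B C) (b, c) w)).hom ≫
        mp (T.map (tensHom (𝟙 A) (assocHom B C D)))
          (toStrengthData.yc (B := tens B C) D a (b, c) w).hom ≫
        mp (T.map (tensHom (𝟙 A) (assocHom B C D))) (mp (T.map (assocHom A (tens B C) D))
          (toStrengthData.tnatLeft (A := tens (tens A B) C) (assocHom A B C) D ((a, b), c) w)) ≫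
        mp (T.map (tensHom (𝟙 A) (assocHom B C D)))
          (compCell T (tensHom (assocHom A B C) (𝟙 D)) (assocHom A (tens B C) D)
            (tensHom (assocHom A B C) (𝟙 D) ≫ assocHom A (tens B C) D) rfl
            (toStrengthData.tob (A := tens (tens A B) C) ((a, b), c) w)).hom ≫
        (sqCell T (tensHom (assocHom A B C) (𝟙 D) ≫ assocHom A (tens B C) D)
          (tensHom (𝟙 A) (assocHom B C D)) (assocHom (tens A B) C D) (assocHom A B (tens C D)) rfl
          (toStrengthData.tob (A := tens (tens A B) C) ((a, b), c) w)).hom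

/-! ## Strengths for pseudomonads on `(Cat, ×, 1)` -/

/-- The data of a left strength for a pseudomonad: a left strength for the underlying
pseudofunctor and families of invertible 2-cells `w` and `z`. -/
structure MonadStrengthData (M : Pseudomonad Cat.{v, u}) extends LeftStrength M.T where
  w (A B : Cat.{v, u}) :
    toStrengthData.st A (M.T.obj B) ≫ M.T.map (toStrengthData.st A B) ≫ M.mu (tens A B) ≅
      tensHom (𝟙 A) (M.mu B) ≫ toStrengthData.st A B
  z (A B : Cat.{v, u}) :
    tensHom (𝟙 A) (M.eta B) ≫ toStrengthData.st A B ≅ M.eta (tens A B)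

namespace MonadStrengthData

variable {M : Pseudomonad Cat.{v, u}} (s : MonadStrengthData M)

/-- The component of `w` at `(a, W)`. -/
def wc {A : Cat.{v, u}} (B : Cat.{v, u}) (a : A) (W : M.T.obj (M.T.obj B)) :
    ob (M.mu (tens A B)) (ob (M.T.map (s.st A B)) (s.tob a W)) ≅ s.tob a (ob (M.mu B) W) :=
  cell (s.w A B) (a, W)

/-- The component of `z` at `(a, b)`. -/
def zc {A B : Cat.{v, u}} (a : A) (b : B) :
    s.tob a (ob (M.eta B) b) ≅ ob (M.eta (tens A B)) (a, b) :=
  cell (s.z A B) (a, b)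

/-- The functor `μ ∘ T t`, from `T (A × T B)` to `T (A × B)`. -/
def muT (A B : Cat.{v, u}) : M.T.obj (tens A (M.T.obj B)) ⟶ M.T.obj (tens A B) :=
  M.T.map (s.st A B) ≫ M.mu (tens A B)

/-- The component at `v` of `T` applied to the naturality 2-cell of `t` at `(f, g)`. -/
def Tnat {A A' B B' : Cat.{v, u}} (f : A ⟶ A') (g : B ⟶ B')
    (v : M.T.obj (tens A (M.T.obj B))) :
    ob (M.T.map (s.st A' B')) (ob (M.T.map (tensHom f (M.T.map g))) v) ≅
      ob (M.T.map (M.T.map (tensHom f g))) (ob (M.T.map (s.st A B)) v) :=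
  cell (Pseudo.mapSquare M.T (s.stNat f g)) v

/-- The component at `v` of `T` applied to `x`. -/
def Tx (A : Cat.{v, u}) (v : M.T.obj (tens one (M.T.obj A))) :
    ob (M.T.map (M.T.map (lam A))) (ob (M.T.map (s.st one A)) v) ≅
      ob (M.T.map (lam (M.T.obj A))) v :=
  cell ((M.T.mapComp _ _).symm ≪≫ M.T.map₂Iso (s.x A)) v

/-- The component at `v` of `T` applied to `y`. -/
def Ty (A B C : Cat.{v, u}) (v : M.T.obj (tens (tens A B) (M.T.obj C))) :
    ob (M.T.map (s.st A (tens B C))) (ob (M.T.map (tensHom (𝟙 A) (s.st B C)))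
        (ob (M.T.map (assocHom A B (M.T.obj C))) v)) ≅
      ob (M.T.map (M.T.map (assocHom A B C))) (ob (M.T.map (s.st (tens A B) C)) v) :=
  compCell M.T (tensHom (𝟙 A) (s.st B C)) (s.st A (tens B C)) _ rfl _ ≪≫
    cell (Pseudo.mapSquare M.T (s.y A B C)) v

/-- The component at `v` of `T` applied to `w`. -/
def Tw (A B : Cat.{v, u}) (v : M.T.obj (tens A (M.T.obj (M.T.obj B)))) :
    ob (M.T.map (M.mu (tens A B))) (ob (M.T.map (M.T.map (s.st A B)))
        (ob (M.T.map (s.st A (M.T.obj B))) v)) ≅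
      ob (M.T.map (s.st A B)) (ob (M.T.map (tensHom (𝟙 A) (M.mu B))) v) :=
  compCell M.T (M.T.map (s.st A B)) (M.mu (tens A B)) _ rfl _ ≪≫
    cell (Pseudo.mapSquare M.T (s.w A B)) v

/-- The component at `v` of `T` applied to `z`. -/
def Tz (A B : Cat.{v, u}) (v : M.T.obj (tens A B)) :
    ob (M.T.map (s.st A B)) (ob (M.T.map (tensHom (𝟙 A) (M.eta B))) v) ≅
      ob (M.T.map (M.eta (tens A B))) v :=
  cell ((M.T.mapComp _ _).symm ≪≫ M.T.map₂Iso (s.z A B)) v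

end MonadStrengthData

/-- A left strength for a pseudomonad on `(Cat, ×, 1)`: the families `w` and `z` are
modifications; three axioms express compatibility with the modifications of the pseudomonad, two
relate `x` to `z` and `w`, and two relate `y` to `w` and `z`. -/
structure PseudomonadStrength (M : Pseudomonad Cat.{v, u}) extends MonadStrengthData M where
  /-- `w` is a modification. -/
  w_naturality {A A' B B' : Cat.{v, u}} (f : A ⟶ A') (g : B ⟶ B') (a : A)
      (W : M.T.obj (M.T.obj B)) :
    (toMonadStrengthData.wc B' (ob f a) (ob (M.T.map (M.T.map g)) W)).hom ≫
        toStrengthData.tmp (𝟙 (ob f a)) (cell (M.muNat g) W).hom ≫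
        (toStrengthData.tnat f g a (ob (M.mu B) W)).hom =
      mp (toMonadStrengthData.muT A' B') (toStrengthData.tnat f (M.T.map g) a W).hom ≫
        mp (M.mu (tens A' B')) (toMonadStrengthData.Tnat f g (toStrengthData.tob a W)).hom ≫
        (cell (M.muNat (tensHom f g))
          (ob (M.T.map (toStrengthData.st A B)) (toStrengthData.tob a W))).hom ≫
        mp (M.T.map (tensHom f g)) (toMonadStrengthData.wc B a W).hom
  /-- `z` is a modification. -/
  z_naturality {A A' B B' : Cat.{v, u}} (f : A ⟶ A') (g : B ⟶ B') (a : A) (b : B) :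
    (toMonadStrengthData.zc (ob f a) (ob g b)).hom ≫
        (cell (M.etaNat (tensHom f g)) (a, b)).hom =
      toStrengthData.tmp (𝟙 (ob f a)) (cell (M.etaNat g) b).hom ≫
        (toStrengthData.tnat f g a (ob (M.eta B) b)).hom ≫
        mp (M.T.map (tensHom f g)) (toMonadStrengthData.zc a b).hom
  /-- Compatibility with `n`, on `A × T B`. -/
  n_axiom {A B : Cat.{v, u}} (a : A) (v : M.T.obj B) :
    (toMonadStrengthData.wc B a (ob (M.eta (M.T.obj B)) v)).hom ≫
        toStrengthData.tmp (𝟙 a) (cell (M.n B) v).hom =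
      mp (toMonadStrengthData.muT A B) (toMonadStrengthData.zc a v).hom ≫
        mp (M.mu (tens A B)) (cell (M.etaNat (toStrengthData.st A B)) (a, v)).inv ≫
        (cell (M.n (tens A B)) (toStrengthData.tob a v)).hom
  /-- Compatibility with `p`, on `A × T B`. -/
  p_axiom {A B : Cat.{v, u}} (a : A) (v : M.T.obj B) :
    (toMonadStrengthData.wc B a (ob (M.T.map (M.eta B)) v)).hom ≫
        toStrengthData.tmp (𝟙 a) (cell (M.p B) v).hom =
      mp (toMonadStrengthData.muT A B) (toStrengthData.tnat (𝟙 A) (M.eta B) a v).hom ≫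
        mp (M.mu (tens A B)) (toMonadStrengthData.Tz A B (toStrengthData.tob a v)).hom ≫
        (cell (M.p (tens A B)) (toStrengthData.tob a v)).hom
  /-- Compatibility with `m`, on `A × T (T (T B))`. -/
  m_axiom {A B : Cat.{v, u}} (a : A) (V : M.T.obj (M.T.obj (M.T.obj B))) :
    (cell (M.m (tens A B)) (ob (M.T.map (M.T.map (toStrengthData.st A B)))
          (ob (M.T.map (toStrengthData.st A (M.T.obj B))) (toStrengthData.tob a V)))).hom ≫
        mp (M.mu (tens A B)) (cell (M.muNat (toStrengthData.st A B))
          (ob (M.T.map (toStrengthData.st A (M.T.obj B))) (toStrengthData.tob a V))).hom ≫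
        mp (toMonadStrengthData.muT A B) (toMonadStrengthData.wc (M.T.obj B) a V).hom ≫
        (toMonadStrengthData.wc B a (ob (M.mu (M.T.obj B)) V)).hom =
      mp (M.mu (tens A B)) (toMonadStrengthData.Tw A B (toStrengthData.tob a V)).hom ≫
        mp (toMonadStrengthData.muT A B) (toStrengthData.tnat (𝟙 A) (M.mu B) a V).inv ≫
        (toMonadStrengthData.wc B a (ob (M.T.map (M.mu B)) V)).hom ≫
        toStrengthData.tmp (𝟙 a) (cell (M.m B) V).hom
  /-- Compatibility of `x` and `z`, on `1 × A`. -/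
  x_z_axiom {A : Cat.{v, u}} (i : one.{v, u}) (a : A) :
    mp (M.T.map (lam A)) (toMonadStrengthData.zc i a).hom ≫
        (cell (M.etaNat (lam A)) (i, a)).inv =
      (toStrengthData.xc A i (ob (M.eta A) a)).hom
  /-- Compatibility of `x` and `w`, on `1 × T (T A)`. -/
  x_w_axiom {A : Cat.{v, u}} (i : one.{v, u}) (W : M.T.obj (M.T.obj A)) :
    mp (M.mu A) (toMonadStrengthData.Tx A (toStrengthData.tob i W)).hom ≫
        mp (M.mu A) (toStrengthData.xc (M.T.obj A) i W).hom =
      (cell (M.muNat (lam A))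
          (ob (M.T.map (toStrengthData.st one A)) (toStrengthData.tob i W))).hom ≫
        mp (M.T.map (lam A)) (toMonadStrengthData.wc A i W).hom ≫
        (toStrengthData.xc A i (ob (M.mu A) W)).hom
  /-- Compatibility of `y` and `w`, on `(A × B) × T (T C)`. -/
  y_w_axiom {A B C : Cat.{v, u}} (a : A) (b : B) (W : M.T.obj (M.T.obj C)) :
    mp (toMonadStrengthData.muT A (tens B C))
          (toStrengthData.tnat (𝟙 A) (toStrengthData.st B C) a (toStrengthData.tob b W)).hom ≫
        mp (toMonadStrengthData.muT A (tens B C))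
          (mp (M.T.map (tensHom (𝟙 A) (toStrengthData.st B C)))
            (toStrengthData.yc (M.T.obj C) a b W).hom) ≫
        mp (M.mu (tens A (tens B C))) (toMonadStrengthData.Ty A B C
          (toStrengthData.tob (A := tens A B) (a, b) W)).hom ≫
        (cell (M.muNat (assocHom A B C)) (ob (M.T.map (toStrengthData.st (tens A B) C))
          (toStrengthData.tob (A := tens A B) (a, b) W))).hom ≫
        mp (M.T.map (assocHom A B C)) (toMonadStrengthData.wc (A := tens A B) C (a, b) W).hom =
      (toMonadStrengthData.wc (tens B C) a
          (ob (M.T.map (toStrengthData.st B C)) (toStrengthData.tob b W))).hom ≫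
        toStrengthData.tmp (𝟙 a) (toMonadStrengthData.wc C b W).hom ≫
        (toStrengthData.yc C a b (ob (M.mu C) W)).hom
  /-- Compatibility of `y` and `z`, on `(A × B) × C`. -/
  y_z_axiom {A B C : Cat.{v, u}} (a : A) (b : B) (c : C) :
    toStrengthData.tmp (𝟙 a) (toMonadStrengthData.zc b c).hom ≫
        (toMonadStrengthData.zc (B := tens B C) a (b, c)).hom =
      (toStrengthData.yc C a b (ob (M.eta C) c)).hom ≫
        mp (M.T.map (assocHom A B C)) (toMonadStrengthData.zc (A := tens A B) (a, b) c).hom ≫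
        (cell (M.etaNat (assocHom A B C)) ((a, b), c)).inv

/-! ## The canonical strength -/

/-- The functor `b ↦ (a, b)`. -/
def pair {A : Cat.{v, u}} (a : A) (B : Cat.{v, u}) : B ⟶ tens A B :=
  (CategoryTheory.Prod.sectR a B).toCatHom

/-- The natural transformation with components `(k, id_b) : (a, b) ⟶ (a', b)`. -/
def pairMap {A : Cat.{v, u}} {a a' : A} (k : a ⟶ a') (B : Cat.{v, u}) :
    pair a B ⟶ pair a' B :=
  Cat.Hom₂.ofNatTrans
    { app := fun b => (k, 𝟙 b)
      naturality := fun _ _ _ => Prod.ext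
        ((Category.id_comp _).trans (Category.comp_id _).symm)
        ((Category.comp_id _).trans (Category.id_comp _).symm) }

/-- `(f × g) ∘ (b ↦ (a, b)) = (b ↦ (f a, b)) ∘ g`. -/
theorem pair_natural {A A' B B' : Cat.{v, u}} (f : A ⟶ A') (g : B ⟶ B') (a : A) :
    g ≫ pair (ob f a) B' = pair a B ≫ tensHom f g := by
  refine Cat.ext (CategoryTheory.Functor.ext (fun _ => rfl) (fun b b' l => ?_))
  refine Prod.ext ?_ ?_
  · change 𝟙 _ = 𝟙 _ ≫ f.toFunctor.map (𝟙 a) ≫ 𝟙 _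
    simp
  · change g.toFunctor.map l = 𝟙 _ ≫ g.toFunctor.map l ≫ 𝟙 _
    simp

/-- The explicit description of the canonical strength: `t (a, w) = T (b ↦ (a, b)) w`, its action
on morphisms, the compositor comparison as the pseudonaturality 2-cells of `t`, and `x` and `y`
given by the compositors and the unitor of `T`. (The morphisms `eqToHom` are the identity: they
rewrite `t (a, w)` as `T (b ↦ (a, b)) w`.) -/
structure IsCanonical {T : Cat.{v, u} ⥤ᵖ Cat.{v, u}} (s : StrengthData T) : Prop where
  tob_eq {A B : Cat.{v, u}} (a : A) (w : T.obj B) : s.tob a w = ob (T.map (pair a B)) w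
  tmp_eq {A B : Cat.{v, u}} {a a' : A} {w w' : T.obj B} (k : a ⟶ a') (l : w ⟶ w') :
    s.tmp k l = eqToHom (tob_eq a w) ≫ (T.map₂ (pairMap k B)).toNatTrans.app w ≫
      mp (T.map (pair a' B)) l ≫ eqToHom (tob_eq a' w').symm
  tnat_eq {A A' B B' : Cat.{v, u}} (f : A ⟶ A') (g : B ⟶ B') (a : A) (w : T.obj B) :
    (s.tnat f g a w).hom =
      eqToHom (tob_eq (ob f a) (ob (T.map g) w)) ≫
        (sqCell T g (pair (ob f a) B') (pair a B) (tensHom f g) (pair_natural f g a) w).hom ≫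
        eqToHom (congrArg (ob (T.map (tensHom f g))) (tob_eq a w).symm)
  x_eq (A : Cat.{v, u}) (i : one.{v, u}) (w : T.obj A) :
    (s.xc A i w).hom =
      eqToHom (congrArg (ob (T.map (lam A))) (tob_eq i w)) ≫
        (compCell T (pair i A) (lam A) (𝟙 A) rfl w).hom ≫ (idCell T A w).hom
  y_eq {A B : Cat.{v, u}} (C : Cat.{v, u}) (a : A) (b : B) (w : T.obj C) :
    (s.yc C a b w).hom =
      eqToHom ((tob_eq a (s.tob b w)).trans
          (congrArg (ob (T.map (pair a (tens B C)))) (tob_eq b w))) ≫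
        (sqCell T (pair b C) (pair a (tens B C)) (pair (A := tens A B) (a, b) C)
          (assocHom A B C) rfl w).hom ≫
        eqToHom (congrArg (ob (T.map (assocHom A B C))) (tob_eq (A := tens A B) (a, b) w).symm)

/-- For a canonical strength, `t_{A, B} ∘ (w ↦ (a, w)) = T (b ↦ (a, b))`. -/
theorem IsCanonical.pair_st {T : Cat.{v, u} ⥤ᵖ Cat.{v, u}} {s : StrengthData T}
    (hs : IsCanonical s) {A : Cat.{v, u}} (a : A) (B : Cat.{v, u}) :
    pair a (T.obj B) ≫ s.st A B = T.map (pair a B) := by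
  refine Cat.ext (CategoryTheory.Functor.ext (fun w => hs.tob_eq a w) (fun w w' l => ?_))
  have h : pairMap (𝟙 a) B = 𝟙 (pair a B) := rfl
  have h' : ((T.map₂ (pairMap (𝟙 a) B)).toNatTrans.app w) = 𝟙 _ := by
    rw [h, T.map₂_id]; rfl
  have key := hs.tmp_eq (𝟙 a) l
  rw [h', Category.id_comp] at key
  exact key

/-- The explicit description of the canonical strength of a pseudomonad: `w` and `z` are given by
the pseudonaturality of `μ` and `η` at the functors `b ↦ (a, b)`. -/
structure IsCanonicalMonad {M : Pseudomonad Cat.{v, u}} (s : MonadStrengthData M) : Prop where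
  canonical : IsCanonical s.toStrengthData
  w_eq {A : Cat.{v, u}} (B : Cat.{v, u}) (a : A) (W : M.T.obj (M.T.obj B)) :
    (s.wc B a W).hom =
      eqToHom (congrArg (ob (s.muT A B)) (canonical.tob_eq a W)) ≫
        mp (M.mu (tens A B)) (compCell M.T (pair a (M.T.obj B)) (s.st A B)
          (M.T.map (pair a B)) (canonical.pair_st a B) W).hom ≫
        (cell (M.muNat (pair a B)) W).hom ≫
        eqToHom (canonical.tob_eq a (ob (M.mu B) W)).symm
  z_eq {A B : Cat.{v, u}} (a : A) (b : B) :
    (s.zc a b).hom =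
      eqToHom (canonical.tob_eq a (ob (M.eta B) b)) ≫ (cell (M.etaNat (pair a B)) b).inv

end CatProd

/-!
For a pseudofunctor `T` on `Cat`, the object `t (a, w)` is `T ⟨a, -⟩ w`, where `⟨a, -⟩` is the
functor `b ↦ (a, b)`. The functors `⟨a, -⟩` satisfy strict equalities with respect to all the
structure of `(Cat, ×, 1)`: `(f × g) ∘ ⟨a, -⟩ = ⟨f a, -⟩ ∘ g`, `λ ∘ ⟨i, -⟩ = id` and
`α ∘ ⟨(a, b), -⟩ = ⟨a, -⟩ ∘ ⟨b, -⟩`. Every 2-cell in the canonical strength of `T` is built from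
compositors and unitors of `T`, so every axiom is an instance of their coherence. To prove such an
equation, both sides are postcomposed with a compositor onto the image of the total composite
1-cell; the lemmas `compCell_comp_right`, `compCell_comp_left`, `sqCell_comp_right` and
`sqCell_comp_left` then collapse each side to the single ternary compositor `compCell₃`. The
modification and coherence axioms follow in this way from `retractCell_prism`, `sqCell_cube`,
`retractCell_middle`, `retractCell_left` and `sqCell_pentagon`.

For a pseudomonad, the strict equality `t ∘ ⟨a, -⟩ = T ⟨a, -⟩` (`pair_canonicalSt`) turns the
pseudonaturality of `μ` at `⟨a, -⟩` into `w`, and that of `η` into `z`. In the axioms on `w` one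
first pastes the pseudonaturality squares of `μ` along a composite (`muNat_comp`) and, for the
axioms on `m`, `n` and `p`, uses that these are modifications at `⟨a, -⟩` (`cell_m_map`,
`cell_n_map`, `cell_p_map`). What remains is the image under `μ` of an equation between compositors
and images `T σ` of the structural 2-cells `σ` of the strength. Restricting `σ` along `⟨a, -⟩` gives
a compositor or a pseudonaturality 2-cell at `⟨a, -⟩` again (`mapSquare_comp`, `mapTriangle_comp`),
and the equation becomes a coherence of compositors (`mulCell_square`, `mulCell_p`, `mulCell_m`,
`mulCell_retract`, `mulCell_assoc`). In `mulCell_n`, and in the axioms on `z` alone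
(`etaNat_square`, `etaNat_inv_square`, `etaNat_retract`), it suffices to paste the pseudonaturality
squares of `η` (`etaNat_comp`).

The coherence lemmas are stated for arbitrary 1-cells of `Cat` satisfying the strict equalities
needed, and only afterwards applied to the functors `⟨a, -⟩`. Two devices make that possible. A
morphism `t (id, l)` is equal to `T ⟨a, -⟩ l`, but not by definition, so the lemmas take such a
morphism `t` together with an equation for it. An equality of 2-cells between 1-cells that are only
propositionally equal is assumed as heterogeneous equality of components.
-/

namespace CatProd

/-! ### Functors, images of 2-cells and compositors, in components -/

section Calculus

theorem cell_hom_naturality {C D : Cat.{v, u}} {F G : C ⟶ D} (σ : F ≅ G) {c c' : C}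
    (k : c ⟶ c') : mp F k ≫ (cell σ c').hom = (cell σ c).hom ≫ mp G k :=
  σ.hom.toNatTrans.naturality k

theorem mp_comp {C D : Cat.{v, u}} (F : C ⟶ D) {a b c : C} (k : a ⟶ b) (l : b ⟶ c) :
    mp F (k ≫ l) = mp F k ≫ mp F l :=
  F.toFunctor.map_comp k l

theorem mp_id {C D : Cat.{v, u}} (F : C ⟶ D) (a : C) : mp F (𝟙 a) = 𝟙 (ob F a) :=
  F.toFunctor.map_id a

theorem mp_hom_inv {C D : Cat.{v, u}} (F : C ⟶ D) {a b : C} (k : a ≅ b) :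
    mp F k.hom ≫ mp F k.inv = 𝟙 _ := by
  rw [← mp_comp, k.hom_inv_id, mp_id]

theorem mp_inv_hom {C D : Cat.{v, u}} (F : C ⟶ D) {a b : C} (k : a ≅ b) :
    mp F k.inv ≫ mp F k.hom = 𝟙 _ := by
  rw [← mp_comp, k.inv_hom_id, mp_id]

/-- Two 2-cells of `Cat` between equal 1-cells agree if their components do. Heterogeneous equality
of components is used so that, for concrete functors whose values agree definitionally, the
hypothesis holds by `HEq.rfl`. -/
theorem eqToHom_comp_eq {A B : Cat.{v, u}} {f f' g g' : A ⟶ B} (σ : f ⟶ g)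
    (θ : f' ⟶ g') (e : f = f') (e' : g = g')
    (H : ∀ x, HEq (θ.toNatTrans.app x) (σ.toNatTrans.app x)) :
    eqToHom e ≫ θ = σ ≫ eqToHom e' := by
  subst e e'
  rw [eqToHom_refl, eqToHom_refl, Category.id_comp, Category.comp_id]
  ext x
  exact eq_of_heq (H x)

variable (T : Cat.{v, u} ⥤ᵖ Cat.{v, u})

/-- The component at `w` of the image under `T` of a 2-cell. -/
def im {A B : Cat.{v, u}} {f g : A ⟶ B} (σ : f ⟶ g) (w : T.obj A) :
    ob (T.map f) w ⟶ ob (T.map g) w :=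
  (T.map₂ σ).toNatTrans.app w

variable {A B C D : Cat.{v, u}}

theorem im_naturality {f g : A ⟶ B} (σ : f ⟶ g) {w w' : T.obj A} (l : w ⟶ w') :
    mp (T.map f) l ≫ im T σ w' = im T σ w ≫ mp (T.map g) l :=
  (T.map₂ σ).toNatTrans.naturality l

theorem im_id (f : A ⟶ B) (w : T.obj A) : im T (𝟙 f) w = 𝟙 _ := by
  rw [im, T.map₂_id]; rfl

theorem im_comp {f g h : A ⟶ B} (σ : f ⟶ g) (τ : g ⟶ h) (w : T.obj A) :
    im T (σ ≫ τ) w = im T σ w ≫ im T τ w := by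
  rw [im, T.map₂_comp]; rfl

theorem compCell_naturality (f : A ⟶ B) (g : B ⟶ C) (h : A ⟶ C) (e : f ≫ g = h)
    {w w' : T.obj A} (l : w ⟶ w') :
    mp (T.map g) (mp (T.map f) l) ≫ (compCell T f g h e w').hom =
      (compCell T f g h e w).hom ≫ mp (T.map h) l :=
  (T.mapComp' f g h e).inv.toNatTrans.naturality l

theorem compCell_rfl (f : A ⟶ B) (g : B ⟶ C) (w : T.obj A) :
    compCell T f g (f ≫ g) rfl w = (cell (T.mapComp f g) w).symm := by
  rw [compCell, T.mapComp'_eq_mapComp]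

/-- Associativity of the compositors, with each composite 1-cell replaced by an arbitrary 1-cell
equal to it. -/
theorem compCell_assoc (f : A ⟶ B) (g : B ⟶ C) (k : C ⟶ D) (fg : A ⟶ C) (gk : B ⟶ D) (h : A ⟶ D)
    (e₁ : f ≫ g = fg) (e₂ : g ≫ k = gk) (e₃ : fg ≫ k = h) (e₄ : f ≫ gk = h) (w : T.obj A) :
    mp (T.map k) (compCell T f g fg e₁ w).hom ≫ (compCell T fg k h e₃ w).hom =
      (compCell T g k gk e₂ (ob (T.map f) w)).hom ≫ (compCell T f gk h e₄ w).hom := by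
  have := congrArg (fun σ => σ.toNatTrans.app w)
    (T.mapComp'_inv_whiskerRight_mapComp'₀₂₃_inv f g k fg gk h e₁ e₂ e₃)
  exact this.trans (Category.id_comp _)

/-- The right unit law of a pseudofunctor. -/
theorem compCell_comp_id (f : A ⟶ B) (w : T.obj A) :
    (compCell T f (𝟙 B) f (Category.comp_id f) w).hom = (idCell T B (ob (T.map f) w)).hom := by
  have := congrArg (fun σ => σ.toNatTrans.app w) (T.mapComp'_comp_id_inv f)
  exact this.trans (Category.comp_id _)

/-- The left unit law of a pseudofunctor. -/
theorem compCell_id_comp (f : A ⟶ B) (w : T.obj A) :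
    (compCell T (𝟙 A) f f (Category.id_comp f) w).hom = mp (T.map f) (idCell T A w).hom := by
  have := congrArg (fun σ => σ.toNatTrans.app w) (T.mapComp'_id_comp_inv f)
  exact this.trans (Category.comp_id _)

/-- Naturality of the compositors in the second 1-cell. The 2-cell `θ` is `f ◁ σ` up to strict
equalities of 1-cells. -/
theorem im_whiskerLeft (f : A ⟶ B) {g g' : B ⟶ C} (σ : g ⟶ g') {h h' : A ⟶ C} (θ : h ⟶ h')
    (e : f ≫ g = h) (e' : f ≫ g' = h') (H : eqToHom e ≫ θ = f ◁ σ ≫ eqToHom e') (w : T.obj A) :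
    im T σ (ob (T.map f) w) ≫ (compCell T f g' h' e' w).hom =
      (compCell T f g h e w).hom ≫ im T θ w := by
  subst e e'
  simp only [eqToHom_refl, Category.id_comp, Category.comp_id] at H
  subst H
  rw [compCell_rfl, compCell_rfl]
  have := congrArg (fun σ => σ.toNatTrans.app w) (T.map₂_whisker_left f σ)
  have h2 : im T (f ◁ σ) w = (cell (T.mapComp f g) w).hom ≫ im T σ (ob (T.map f) w) ≫
    (cell (T.mapComp f g') w).inv := this
  rw [h2]
  simp

/-- Naturality of the compositors in the first 1-cell. The 2-cell `θ` is `σ ▷ g` up to strict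
equalities of 1-cells. -/
theorem im_whiskerRight {f f' : A ⟶ B} (σ : f ⟶ f') (g : B ⟶ C) {h h' : A ⟶ C} (θ : h ⟶ h')
    (e : f ≫ g = h) (e' : f' ≫ g = h') (H : eqToHom e ≫ θ = σ ▷ g ≫ eqToHom e') (w : T.obj A) :
    mp (T.map g) (im T σ w) ≫ (compCell T f' g h' e' w).hom =
      (compCell T f g h e w).hom ≫ im T θ w := by
  subst e e'
  simp only [eqToHom_refl, Category.id_comp, Category.comp_id] at H
  subst H
  rw [compCell_rfl, compCell_rfl]
  have := congrArg (fun σ => σ.toNatTrans.app w) (T.map₂_whisker_right σ g)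
  have h2 : im T (σ ▷ g) w = (cell (T.mapComp f g) w).hom ≫ mp (T.map g) (im T σ w) ≫
    (cell (T.mapComp f' g) w).inv := this
  rw [h2]
  simp

end Calculus

/-! ### Compositor comparisons along commutative squares -/

section Calculus

variable (T : Cat.{v, u} ⥤ᵖ Cat.{v, u})
variable {A B C D : Cat.{v, u}}

theorem sqCell_hom {B' : Cat.{v, u}} (f : A ⟶ B) (g : B ⟶ C) (h : A ⟶ B') (k : B' ⟶ C)
    (e : f ≫ g = h ≫ k) (w : T.obj A) :
    (sqCell T f g h k e w).hom =
      (compCell T f g (h ≫ k) e w).hom ≫ (compCell T h k (h ≫ k) rfl w).inv := rfl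

/-- The comparison `T g ∘ T f ≅ T k ∘ T h` may be computed through any 1-cell equal to the common
composite. -/
theorem sqCell_hom_comp {B' : Cat.{v, u}} (f : A ⟶ B) (g : B ⟶ C) (h : A ⟶ B') (k : B' ⟶ C)
    (e : f ≫ g = h ≫ k) (l : A ⟶ C) (e₁ : f ≫ g = l) (e₂ : h ≫ k = l) (w : T.obj A) :
    (sqCell T f g h k e w).hom ≫ (compCell T h k l e₂ w).hom = (compCell T f g l e₁ w).hom := by
  subst e₂
  simp [sqCell_hom]

/-- Vertical pasting of compositor squares. -/
theorem sqCell_comp {A B C A' B' C' : Cat.{v, u}} (f : A ⟶ B) (g : B ⟶ C) (p : A ⟶ A')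
    (q : B ⟶ B') (r : C ⟶ C') (f' : A' ⟶ B') (g' : B' ⟶ C') (e : f ≫ q = p ≫ f')
    (e' : g ≫ r = q ≫ g') (e'' : (f ≫ g) ≫ r = p ≫ (f' ≫ g')) (w : T.obj A) :
    mp (T.map r) (compCell T f g (f ≫ g) rfl w).hom ≫ (sqCell T (f ≫ g) r p (f' ≫ g') e'' w).hom =
      (sqCell T g r q g' e' (ob (T.map f) w)).hom ≫ mp (T.map g') (sqCell T f q p f' e w).hom ≫
        (compCell T f' g' (f' ≫ g') rfl (ob (T.map p) w)).hom := by
  have e2 : f ≫ q ≫ g' = p ≫ f' ≫ g' := by rw [← e']; exact e''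
  rw [← cancel_mono (compCell T p (f' ≫ g') _ rfl w).hom, Category.assoc, Category.assoc,
    Category.assoc, sqCell_hom_comp _ _ _ _ _ _ _ e'',
    compCell_assoc T f g r (f ≫ g) (q ≫ g') _ rfl e' e'' e2,
    ← compCell_assoc T p f' g' (p ≫ f') (f' ≫ g') (p ≫ f' ≫ g') rfl rfl rfl rfl,
    ← Category.assoc (mp _ _) (mp _ _), ← mp_comp, sqCell_hom_comp _ _ _ _ _ _ _ e,
    compCell_assoc T f q g' (p ≫ f') (q ≫ g') (p ≫ f' ≫ g') e rfl rfl e2,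
    reassoc_of% (sqCell_hom_comp T g r q g' e' (q ≫ g') e' rfl)]

/-- Pasting of compositor comparisons, in the form required of the pseudonaturality 2-cell at a
composite. -/
theorem sqCell_comp_mapComp {A B C A' B' C' : Cat.{v, u}} (f : A ⟶ B) (g : B ⟶ C) (p : A ⟶ A')
    (q : B ⟶ B') (r : C ⟶ C') (f' : A' ⟶ B') (g' : B' ⟶ C') (e : f ≫ q = p ≫ f')
    (e' : g ≫ r = q ≫ g') (e'' : (f ≫ g) ≫ r = p ≫ (f' ≫ g')) (w : T.obj A) :
    (sqCell T (f ≫ g) r p (f' ≫ g') e'' w).hom ≫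
        (cell (T.mapComp f' g') (ob (T.map p) w)).hom =
      mp (T.map r) (cell (T.mapComp f g) w).hom ≫
        (sqCell T g r q g' e' (ob (T.map f) w)).hom ≫
          mp (T.map g') (sqCell T f q p f' e w).hom := by
  have h := sqCell_comp T f g p q r f' g' e e' e'' w
  rw [compCell_rfl, compCell_rfl, Iso.symm_hom, Iso.symm_hom] at h
  have h' := mp_hom_inv (T.map r) (cell (T.mapComp f g) w)
  have hs : (sqCell T (f ≫ g) r p (f' ≫ g') e'' w).hom = mp (T.map r) (cell (T.mapComp f g) w).hom ≫
      (sqCell T g r q g' e' (ob (T.map f) w)).hom ≫ mp (T.map g') (sqCell T f q p f' e w).hom ≫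
        (cell (T.mapComp f' g') (ob (T.map p) w)).inv := by
    rw [← h, reassoc_of% h']
  rw [hs, Category.assoc, Category.assoc, Category.assoc]
  exact congrArg _ (congrArg _ ((congrArg _ (Iso.inv_hom_id _)).trans (Category.comp_id _)))

end Calculus

/-! ### The pseudonatural transformation `t` -/

section Strength

variable (T : Cat.{v, u} ⥤ᵖ Cat.{v, u})

theorem pairMap_comp {A : Cat.{v, u}} {a a' a'' : A} (k : a ⟶ a') (k' : a' ⟶ a'')
    (B : Cat.{v, u}) : pairMap (k ≫ k') B = pairMap k B ≫ pairMap k' B := by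
  ext b
  exact Prod.ext rfl (Category.comp_id _).symm

theorem im_pairMap_id {A B : Cat.{v, u}} (a : A) (w : T.obj B) :
    im T (pairMap (𝟙 a) B) w = 𝟙 (ob (T.map (pair a B)) w) :=
  im_id T (pair a B) w

/-- The functor `(a, w) ↦ T ⟨a, -⟩ w`. -/
def canonicalSt (A B : Cat.{v, u}) : tens A (T.obj B) ⟶ T.obj (tens A B) :=
  Functor.toCatHom
    { obj := fun p => ob (T.map (pair p.1 B)) p.2
      map := fun {p q} k => im T (pairMap k.1 B) p.2 ≫ mp (T.map (pair q.1 B)) k.2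
      map_id := fun p => by
        change im T (pairMap (𝟙 p.1) B) p.2 ≫ mp (T.map (pair p.1 B)) (𝟙 p.2) = 𝟙 _
        rw [im_pairMap_id, mp_id, Category.comp_id]
      map_comp := fun {p q r} k l => by
        change im T (pairMap (k.1 ≫ l.1) B) p.2 ≫ mp (T.map (pair r.1 B)) (k.2 ≫ l.2) = _
        rw [pairMap_comp, im_comp, mp_comp, Category.assoc, Category.assoc,
          ← reassoc_of% (im_naturality T (pairMap l.1 B) k.2)] }

/-- The compositor comparisons are natural in `(a, w)`, so they form a 2-cell of `Cat`. -/
theorem canonicalNat_natural {A A' B B' : Cat.{v, u}} (f : A ⟶ A') (g : B ⟶ B') {a a' : A}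
    {w w' : T.obj B} (k : a ⟶ a') (l : w ⟶ w') :
    (im T (pairMap (mp f k) B') (ob (T.map g) w) ≫
          mp (T.map (pair (ob f a') B')) (mp (T.map g) l)) ≫
        (sqCell T g (pair (ob f a') B') (pair a' B) (tensHom f g) (pair_natural f g a') w').hom =
      (sqCell T g (pair (ob f a) B') (pair a B) (tensHom f g) (pair_natural f g a) w).hom ≫
        mp (T.map (tensHom f g)) (im T (pairMap k B) w ≫ mp (T.map (pair a' B)) l) := by
  rw [← cancel_mono (compCell T (pair a' B) (tensHom f g) _ rfl w').hom, Category.assoc,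
    Category.assoc, sqCell_hom_comp _ _ _ _ _ _ _ (pair_natural f g a'), compCell_naturality,
    ← Category.assoc, im_whiskerLeft T g (pairMap (mp f k) B') (pairMap k B ▷ tensHom f g)
      (pair_natural f g a) (pair_natural f g a'), mp_comp, Category.assoc, Category.assoc,
    Category.assoc, compCell_naturality,
    reassoc_of% (im_whiskerRight T (pairMap k B) (tensHom f g) (pairMap k B ▷ tensHom f g) rfl rfl
      (by simp)), ← Category.assoc (sqCell T _ _ _ _ _ _).hom,
    sqCell_hom_comp _ _ _ _ _ _ _ (pair_natural f g a)]
  refine eqToHom_comp_eq _ _ _ _ (fun b => heq_of_eq (Prod.ext rfl ?_))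
  exact g.toFunctor.map_id b

/-- The pseudonaturality 2-cell of the canonical strength at `(f, g)`, with components the
compositor isomorphisms. -/
def canonicalNat {A A' B B' : Cat.{v, u}} (f : A ⟶ A') (g : B ⟶ B') :
    tensHom f (T.map g) ≫ canonicalSt T A' B' ≅ canonicalSt T A B ≫ T.map (tensHom f g) :=
  Cat.Hom.isoMk (NatIso.ofComponents
    (F := (tensHom f (T.map g) ≫ canonicalSt T A' B').toFunctor)
    (G := (canonicalSt T A B ≫ T.map (tensHom f g)).toFunctor)
    (fun p => sqCell T g (pair (ob f p.1) B') (pair p.1 B) (tensHom f g)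
      (pair_natural f g p.1) p.2)
    (fun k => canonicalNat_natural T f g k.1 k.2))

/-- The compositor comparisons are natural in the 1-cells `f` and `g`. -/
theorem canonicalNat_naturality {A A' B B' : Cat.{v, u}} {f f' : A ⟶ A'} {g g' : B ⟶ B'}
    (σ : f ⟶ f') (τ : g ⟶ g') (a : A) (w : T.obj B) :
    (im T (pairMap (σ.toNatTrans.app a) B') (ob (T.map g) w) ≫
          mp (T.map (pair (ob f' a) B')) (im T τ w)) ≫
        (sqCell T g' (pair (ob f' a) B') (pair a B) (tensHom f' g') (pair_natural f' g' a) w).hom =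
      (sqCell T g (pair (ob f a) B') (pair a B) (tensHom f g) (pair_natural f g a) w).hom ≫
        im T (tensHom₂ σ τ) (ob (T.map (pair a B)) w) := by
  have h1 := im_whiskerLeft T g (pairMap (σ.toNatTrans.app a) B')
    (g ◁ pairMap (σ.toNatTrans.app a) B') rfl rfl (by simp) w
  have h2 := im_whiskerRight T τ (pair (ob f' a) B') (τ ▷ pair (ob f' a) B') rfl rfl
    (by simp) w
  have h3 := im_whiskerLeft T (pair a B) (tensHom₂ σ τ)
    (g ◁ pairMap (σ.toNatTrans.app a) B' ≫ τ ▷ pair (ob f' a) B')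
    (pair_natural f g a).symm (pair_natural f' g' a).symm (eqToHom_comp_eq _ _ _ _ (fun b =>
      heq_of_eq (Prod.ext (Category.comp_id _) (Category.id_comp _)))) w
  rw [← cancel_mono (compCell T (pair a B) (tensHom f' g') _ (pair_natural f' g' a).symm w).hom,
    Category.assoc, Category.assoc, Category.assoc, sqCell_hom_comp _ _ _ _ _ _ _ rfl, h2, h3,
    reassoc_of% h1, im_comp, reassoc_of% (sqCell_hom_comp T g _ _ _ (pair_natural f g a) _ rfl
      (pair_natural f g a).symm w)]

/-- The compositor comparison at identity 1-cells is given by the unitors. -/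
theorem canonicalNat_id (A B : Cat.{v, u}) (a : A) (w : T.obj B) :
    (sqCell T (𝟙 B) (pair a B) (pair a B) (tensHom (𝟙 A) (𝟙 B))
          (pair_natural (𝟙 A) (𝟙 B) a) w).hom ≫
        (idCell T (tens A B) (ob (T.map (pair a B)) w)).hom =
      mp (T.map (pair a B)) (idCell T B w).hom := by
  rw [← compCell_comp_id, ← compCell_id_comp]
  exact sqCell_hom_comp T (𝟙 B) (pair a B) (pair a B) (𝟙 _) _ _ _ _ w

theorem mp_canonicalSt_id {A B : Cat.{v, u}} (a : A) {w w' : T.obj B} (l : w ⟶ w') :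
    mp (canonicalSt T A B) (c := (a, w)) (c' := (a, w')) (𝟙 a, l) = mp (T.map (pair a B)) l := by
  change im T (pairMap (𝟙 a) B) w ≫ mp (T.map (pair a B)) l = _
  rw [im_pairMap_id, Category.id_comp]

theorem mp_canonicalSt_id_comp {A B : Cat.{v, u}} (a : A) {w w' : T.obj B} (l : w ⟶ w') :
    mp (canonicalSt T A B) (c := (a, w)) (c' := (a, w'))
        (CategoryStruct.comp (Y := ((a, w') : tens A (T.obj B))) (𝟙 a, l) (𝟙 a, 𝟙 w')) =
      mp (T.map (pair a B)) l :=
  (congrArg (mp (canonicalSt T A B)) (Category.comp_id (X := ((a, w) : tens A (T.obj B)))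
    (Y := (a, w')) (𝟙 a, l))).trans (mp_canonicalSt_id T a l)

/-- The unit law of pseudonaturality, spelled out in components: the identity morphisms are those
contributed by the whiskerings and structural 2-cells of `Cat`. -/
theorem canonicalNat_unit (A B : Cat.{v, u}) (a : A) (w : T.obj B) :
    (sqCell T (𝟙 B) (pair a B) (pair a B) (tensHom (𝟙 A) (𝟙 B))
          (pair_natural (𝟙 A) (𝟙 B) a) w).hom ≫
        im T (𝟙 (𝟙 (tens A B))) (ob (T.map (pair a B)) w) ≫
          (idCell T (tens A B) (ob (T.map (pair a B)) w)).hom =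
      mp (canonicalSt T A B) (c := (a, ob (T.map (𝟙 B)) w)) (c' := (a, w))
        (CategoryStruct.comp (Y := ((a, w) : tens A (T.obj B)))
          (𝟙 a, (idCell T B w).hom) (𝟙 a, 𝟙 w)) ≫ 𝟙 (ob (T.map (pair a B)) w) ≫ 𝟙 _ := by
  rw [im_id, mp_canonicalSt_id_comp, ← canonicalNat_id]
  exact (congrArg _ (Category.id_comp _)).trans
    ((congrArg _ (Category.id_comp _)).trans (Category.comp_id _)).symm

/-- The composition law of pseudonaturality, spelled out in components: the identity morphisms are
those contributed by the whiskerings and structural 2-cells of `Cat`. -/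
theorem canonicalNat_comp {A A' A'' B B' B'' : Cat.{v, u}} (f : A ⟶ A') (f' : A' ⟶ A'')
    (g : B ⟶ B') (g' : B' ⟶ B'') (a : A) (w : T.obj B) :
    (sqCell T (g ≫ g') (pair (ob (f ≫ f') a) B'') (pair a B)
          (tensHom f g ≫ tensHom f' g') (pair_natural (f ≫ f') (g ≫ g') a) w).hom ≫
        im T (𝟙 (tensHom f g ≫ tensHom f' g')) (ob (T.map (pair a B)) w) ≫
          (cell (T.mapComp (tensHom f g) (tensHom f' g')) (ob (T.map (pair a B)) w)).hom =
      mp (canonicalSt T A'' B'') (c := (ob (f ≫ f') a, ob (T.map (g ≫ g')) w))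
          (c' := (ob (f ≫ f') a, ob (T.map g ≫ T.map g') w))
          (CategoryStruct.comp
            (Y := ((ob (f ≫ f') a, ob (T.map g ≫ T.map g') w) : tens A'' (T.obj B'')))
            (𝟙 _, (cell (T.mapComp g g') w).hom) (𝟙 _, 𝟙 _)) ≫
        𝟙 (ob (T.map (pair (ob (f ≫ f') a) B'')) (ob (T.map g') (ob (T.map g) w))) ≫
        (sqCell T g' (pair (ob f' (ob f a)) B'') (pair (ob f a) B') (tensHom f' g')
          (pair_natural f' g' (ob f a)) (ob (T.map g) w)).hom ≫ 𝟙 _ ≫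
        mp (T.map (tensHom f' g')) (sqCell T g (pair (ob f a) B') (pair a B)
          (tensHom f g) (pair_natural f g a) w).hom ≫ 𝟙 _ := by
  rw [im_id, mp_canonicalSt_id_comp]
  refine (congrArg _ (Category.id_comp _)).trans (Eq.trans
    (sqCell_comp_mapComp T g g' (pair a B) (pair (ob f a) B') (pair (ob f' (ob f a)) B'')
      (tensHom f g) (tensHom f' g') (pair_natural f g a)
      (pair_natural f' g' (ob f a)) (pair_natural (f ≫ f') (g ≫ g') a) w) (congrArg _ ?_))
  exact ((Category.id_comp _).trans (congrArg _ ((Category.id_comp _).trans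
    (Category.comp_id _)))).symm

/-- The canonical pseudonatural transformation `A × T B ⟶ T (A × B)`. -/
def canonicalTrans : StrengthTrans T where
  app X := canonicalSt T X.1 X.2
  naturality f := canonicalNat T f.1 f.2
  naturality_naturality σ := by
    ext p
    exact canonicalNat_naturality T σ.1 σ.2 p.1 p.2
  naturality_id X := by
    ext p
    exact canonicalNat_unit T X.1 X.2 p.1 p.2
  naturality_comp f g := by
    ext p
    exact canonicalNat_comp T f.1 g.1 f.2 g.2 p.1 p.2

end Strength

/-! ### Coherence of compositors -/

section Calculus

variable (T : Cat.{v, u} ⥤ᵖ Cat.{v, u})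
variable {A B C D : Cat.{v, u}}

/-- The component at `w` of the compositor `T k ∘ T g ∘ T f ≅ T h`, where `h = k ∘ g ∘ f`. -/
def compCell₃ (f : A ⟶ B) (g : B ⟶ C) (k : C ⟶ D) (h : A ⟶ D) (e : f ≫ g ≫ k = h) (w : T.obj A) :
    ob (T.map k) (ob (T.map g) (ob (T.map f) w)) ≅ ob (T.map h) w :=
  compCell T g k (g ≫ k) rfl (ob (T.map f) w) ≪≫ compCell T f (g ≫ k) h e w

/-- One bracketing of the ternary compositor. Together with `compCell_comp_left`, it reduces
coherence of compositors to a comparison of both sides with `compCell₃`. -/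
theorem compCell_comp_right (f : A ⟶ B) (g : B ⟶ C) (k : C ⟶ D) (h : A ⟶ D) (gk : B ⟶ D)
    (e : g ≫ k = gk) (e' : f ≫ gk = h) (w : T.obj A) :
    (compCell T g k gk e (ob (T.map f) w)).hom ≫ (compCell T f gk h e' w).hom =
      (compCell₃ T f g k h (by rw [e, e']) w).hom := by
  subst e
  rfl

/-- The other bracketing of the ternary compositor. -/
theorem compCell_comp_left (f : A ⟶ B) (g : B ⟶ C) (k : C ⟶ D) (h : A ⟶ D) (fg : A ⟶ C)
    (e : f ≫ g = fg) (e' : fg ≫ k = h) (w : T.obj A) :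
    mp (T.map k) (compCell T f g fg e w).hom ≫ (compCell T fg k h e' w).hom =
      (compCell₃ T f g k h (by rw [← e', ← e]; rfl) w).hom :=
  compCell_assoc T f g k fg (g ≫ k) h e rfl e' _ w

theorem sqCell_comp_right {C' : Cat.{v, u}} (f : A ⟶ B) (g : B ⟶ C) (k : C ⟶ D) (g' : B ⟶ C')
    (k' : C' ⟶ D) (h : A ⟶ D) (e : g ≫ k = g' ≫ k') (e' : f ≫ g' ≫ k' = h) (w : T.obj A) :
    (sqCell T g k g' k' e (ob (T.map f) w)).hom ≫ (compCell₃ T f g' k' h e' w).hom =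
      (compCell₃ T f g k h (by rw [e, e']) w).hom := by
  rw [← compCell_comp_right T f g' k' h _ rfl e',
    reassoc_of% (sqCell_hom_comp T g k g' k' e _ e rfl),
    compCell_comp_right]

theorem sqCell_comp_left {B' : Cat.{v, u}} (f : A ⟶ B) (g : B ⟶ C) (f' : A ⟶ B')
    (g' : B' ⟶ C) (k : C ⟶ D) (h : A ⟶ D) (e : f ≫ g = f' ≫ g') (e' : f' ≫ g' ≫ k = h)
    (w : T.obj A) :
    mp (T.map k) (sqCell T f g f' g' e w).hom ≫ (compCell₃ T f' g' k h e' w).hom =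
      (compCell₃ T f g k h (by rw [← e']; exact congrArg (· ≫ k) e) w).hom := by
  rw [← compCell_comp_left T f' g' k h _ rfl e', ← Category.assoc (mp _ _), ← mp_comp,
    sqCell_hom_comp T f g f' g' e _ e rfl, compCell_comp_left]

/-- The compositor comparisons on the faces of a commutative cube commute. -/
theorem sqCell_cube {A B C D A' B' C' D' : Cat.{v, u}} (f : A ⟶ B) (g : B ⟶ D) (h : A ⟶ C)
    (k : C ⟶ D) (f' : A' ⟶ B') (g' : B' ⟶ D') (h' : A' ⟶ C') (k' : C' ⟶ D') (a : A ⟶ A')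
    (b : B ⟶ B') (c : C ⟶ C') (d : D ⟶ D') (e : f ≫ g = h ≫ k) (e' : f' ≫ g' = h' ≫ k')
    (ef : a ≫ f' = f ≫ b) (eg : b ≫ g' = g ≫ d) (eh : a ≫ h' = h ≫ c) (ek : c ≫ k' = k ≫ d)
    (w : T.obj A) :
    (sqCell T f' g' h' k' e' (ob (T.map a) w)).hom ≫ mp (T.map k') (sqCell T a h' h c eh w).hom ≫
        (sqCell T c k' k d ek (ob (T.map h) w)).hom =
      mp (T.map g') (sqCell T a f' f b ef w).hom ≫
        (sqCell T b g' g d eg (ob (T.map f) w)).hom ≫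
        mp (T.map d) (sqCell T f g h k e w).hom := by
  rw [← cancel_mono (compCell₃ T h k d _ rfl w).hom]
  simp only [Category.assoc]
  rw [sqCell_comp_right, sqCell_comp_left, sqCell_comp_right, sqCell_comp_left, sqCell_comp_right,
    sqCell_comp_left]

/-- The component at `w` of the isomorphism `T l ∘ T p ≅ id`, where `l ∘ p = id`. -/
def retractCell (p : A ⟶ B) (l : B ⟶ A) (e : p ≫ l = 𝟙 A) (w : T.obj A) :
    ob (T.map l) (ob (T.map p) w) ≅ w :=
  compCell T p l (𝟙 A) e w ≪≫ idCell T A w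

theorem retractCell_after (f : A ⟶ B) (p : B ⟶ C) (l : C ⟶ B) (e : p ≫ l = 𝟙 B) (w : T.obj A) :
    (retractCell T p l e (ob (T.map f) w)).hom =
      (compCell₃ T f p l f (by rw [e, Category.comp_id]) w).hom := by
  rw [retractCell, Iso.trans_hom, ← compCell_comp_id, compCell_comp_right]

theorem mp_retractCell (p : A ⟶ B) (l : B ⟶ A) (f : A ⟶ C) (e : p ≫ l = 𝟙 A) (w : T.obj A) :
    mp (T.map f) (retractCell T p l e w).hom =
      (compCell₃ T p l f f (by rw [← Category.assoc, e, Category.id_comp]) w).hom := by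
  rw [retractCell, Iso.trans_hom, mp_comp, ← compCell_id_comp, compCell_comp_left]

theorem mp_compCell_inv_comp (f : A ⟶ B) (g : B ⟶ C) (k : C ⟶ D) (fg : A ⟶ C) (gk : B ⟶ D)
    (e : f ≫ g = fg) (e' : g ≫ k = gk) (e'' : fg ≫ k = f ≫ gk) (w : T.obj A) :
    mp (T.map k) (compCell T f g fg e w).inv ≫ (compCell T g k gk e' (ob (T.map f) w)).hom =
      (sqCell T fg k f gk e'' w).hom := by
  rw [← cancel_mono (compCell T f gk _ rfl w).hom, sqCell_hom_comp T fg k f gk e'' _ e'' rfl,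
    Category.assoc, compCell_comp_right, ← compCell_comp_left T f g k _ fg e e'',
    reassoc_of% (mp_inv_hom (T.map k) (compCell T f g fg e w))]

theorem compCell_comp_im_eqToHom (f : A ⟶ B) (g : B ⟶ C) (h : A ⟶ C) (e : f ≫ g = h)
    (w : T.obj A) :
    (compCell T f g (f ≫ g) rfl w).hom ≫ im T (eqToHom e) w = (compCell T f g h e w).hom := by
  subst e
  rw [eqToHom_refl, im_id, Category.comp_id]

/-- Compositor comparisons are natural in the object. -/
theorem sqCell_naturality {B' : Cat.{v, u}} (f : A ⟶ B) (g : B ⟶ C) (h : A ⟶ B') (k : B' ⟶ C)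
    (e : f ≫ g = h ≫ k) {w w' : T.obj A} (l : w ⟶ w') :
    mp (T.map g) (mp (T.map f) l) ≫ (sqCell T f g h k e w').hom =
      (sqCell T f g h k e w).hom ≫ mp (T.map k) (mp (T.map h) l) := by
  rw [← cancel_mono (compCell T h k _ rfl w').hom, Category.assoc, Category.assoc,
    compCell_naturality, sqCell_hom_comp T f g h k e _ e rfl, compCell_naturality,
    reassoc_of% (sqCell_hom_comp T f g h k e _ e rfl)]

theorem retractCell_naturality (p : A ⟶ B) (l : B ⟶ A) (e : p ≫ l = 𝟙 A) {w w' : T.obj A}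
    (k : w ⟶ w') :
    mp (T.map l) (mp (T.map p) k) ≫ (retractCell T p l e w').hom =
      (retractCell T p l e w).hom ≫ k := by
  rw [retractCell, retractCell, Iso.trans_hom, Iso.trans_hom, Category.assoc,
    reassoc_of% (compCell_naturality T p l (𝟙 A) e k)]
  exact congrArg _ (cell_hom_naturality (T.mapId A) k)

theorem retractCell_im {p q : A ⟶ B} (σ : p ⟶ q) (l : B ⟶ A) (e : p ≫ l = 𝟙 A)
    (e' : q ≫ l = 𝟙 A) (H : ∀ x, HEq (𝟙 x) ((σ ▷ l).toNatTrans.app x)) (w : T.obj A) :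
    mp (T.map l) (im T σ w) ≫ (retractCell T q l e' w).hom = (retractCell T p l e w).hom := by
  rw [retractCell, retractCell, Iso.trans_hom, Iso.trans_hom,
    reassoc_of% (im_whiskerRight T σ l (𝟙 (𝟙 A)) e e' (eqToHom_comp_eq _ _ _ _ H)), im_id,
    Category.id_comp]

/-- Compositor comparisons are natural in all four 1-cells. -/
theorem sqCell_im {B' : Cat.{v, u}} {f f₁ : A ⟶ B} {g g₁ : B ⟶ C} {h h₁ : A ⟶ B'} {k k₁ : B' ⟶ C}
    (σ : f ⟶ f₁) (τ : g ⟶ g₁) (ρ : h ⟶ h₁) (κ : k ⟶ k₁) (e : f ≫ g = h ≫ k)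
    (e₁ : f₁ ≫ g₁ = h₁ ≫ k₁)
    (H : ∀ x, HEq ((h ◁ κ ≫ ρ ▷ k₁).toNatTrans.app x) ((f ◁ τ ≫ σ ▷ g₁).toNatTrans.app x))
    (w : T.obj A) :
    im T τ (ob (T.map f) w) ≫ mp (T.map g₁) (im T σ w) ≫ (sqCell T f₁ g₁ h₁ k₁ e₁ w).hom =
      (sqCell T f g h k e w).hom ≫ im T κ (ob (T.map h) w) ≫ mp (T.map k₁) (im T ρ w) := by
  have H' := eqToHom_comp_eq _ _ e e₁ H
  rw [← cancel_mono (compCell T h₁ k₁ _ rfl w).hom]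
  simp only [Category.assoc]
  rw [sqCell_hom_comp T f₁ g₁ h₁ k₁ e₁ _ e₁ rfl,
    im_whiskerRight T ρ k₁ (ρ ▷ k₁) rfl rfl (by simp),
    reassoc_of% (im_whiskerLeft T h κ (h ◁ κ) rfl rfl (by simp)), ← im_comp,
    reassoc_of% (sqCell_hom_comp T f g h k e _ e rfl),
    im_whiskerRight T σ g₁ (σ ▷ g₁ ≫ eqToHom e₁) rfl e₁ (by simp),
    reassoc_of% (im_whiskerLeft T f τ (f ◁ τ) rfl rfl (by simp)), ← im_comp,
    ← Category.assoc (f ◁ τ), ← H', im_comp, reassoc_of% (compCell_comp_im_eqToHom T f g _ e)]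

/-- Compositor comparisons are natural in the object and in three of the 1-cells; this is naturality
of `y`. -/
theorem sqCell_im_naturality {B' : Cat.{v, u}} {f f₁ : A ⟶ B} {g g₁ : B ⟶ C} {h h₁ : A ⟶ B'}
    (σ : f ⟶ f₁) (τ : g ⟶ g₁) (ρ : h ⟶ h₁) (k : B' ⟶ C) (e : f ≫ g = h ≫ k)
    (e₁ : f₁ ≫ g₁ = h₁ ≫ k)
    (H : ∀ x, HEq ((h ◁ 𝟙 k ≫ ρ ▷ k).toNatTrans.app x) ((f ◁ τ ≫ σ ▷ g₁).toNatTrans.app x))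
    {w w' : T.obj A} (l : w ⟶ w') :
    (im T τ (ob (T.map f) w) ≫ mp (T.map g₁) (im T σ w ≫ mp (T.map f₁) l)) ≫
        (sqCell T f₁ g₁ h₁ k e₁ w').hom =
      (sqCell T f g h k e w).hom ≫ mp (T.map k) (im T ρ w ≫ mp (T.map h₁) l) := by
  have h1 := sqCell_im T σ τ ρ (𝟙 k) e e₁ H w
  rw [im_id, Category.id_comp] at h1
  rw [mp_comp, mp_comp, Category.assoc, Category.assoc, sqCell_naturality, reassoc_of% h1]

/-- The compositor comparisons on the faces of a commutative triangular prism commute, in the case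
where the triangles are retractions. -/
theorem retractCell_prism {A' B' : Cat.{v, u}} (p : A ⟶ B) (l : B ⟶ A) (p' : A' ⟶ B') (l' : B' ⟶ A')
    (f : A ⟶ A') (g : B ⟶ B') (e : p ≫ l = 𝟙 A) (e' : p' ≫ l' = 𝟙 A') (e₁ : f ≫ p' = p ≫ g)
    (e₂ : g ≫ l' = l ≫ f) (w : T.obj A) :
    (retractCell T p' l' e' (ob (T.map f) w)).hom =
      mp (T.map l') (sqCell T f p' p g e₁ w).hom ≫ (sqCell T g l' l f e₂ (ob (T.map p) w)).hom ≫
        mp (T.map f) (retractCell T p l e w).hom := by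
  rw [mp_retractCell, retractCell_after, sqCell_comp_right, sqCell_comp_left]

/-- The compositor coherence behind the middle unit axiom. -/
theorem retractCell_middle {B' : Cat.{v, u}} (p : A ⟶ B) (l : B ⟶ A) (a : A ⟶ C) (q : B ⟶ D)
    (m : D ⟶ C) (r : A ⟶ B') (s : B' ⟶ D) (n : B' ⟶ C) (e : p ≫ l = 𝟙 A) (e₁ : l ≫ a = q ≫ m)
    (e₂ : p ≫ q = r ≫ s) (e₃ : s ≫ m = n) (e₄ : r ≫ n = a) (w : T.obj A)
    (t₁ : ob (T.map a) (ob (T.map l) (ob (T.map p) w)) ⟶ ob (T.map a) w)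
    (h₁ : t₁ = mp (T.map a) (retractCell T p l e w).hom)
    (t₂ : ob (T.map a) w ⟶ ob (T.map n) (ob (T.map r) w))
    (h₂ : t₂ = (compCell T r n a e₄ w).inv) :
    (sqCell T l a q m e₁ (ob (T.map p) w)).inv ≫ t₁ ≫ t₂ =
      mp (T.map m) (sqCell T p q r s e₂ w).hom ≫
        (compCell T s m n e₃ (ob (T.map r) w)).hom := by
  subst h₁ h₂
  rw [Iso.inv_comp_eq, ← cancel_mono (compCell T r n a e₄ w).hom]
  simp only [Category.assoc]
  rw [Iso.inv_hom_id, Category.comp_id, mp_retractCell, compCell_comp_right, sqCell_comp_left,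
    sqCell_comp_right]

/-- The compositor coherence behind the left unit axiom. -/
theorem retractCell_left (a : A ⟶ B) (p : B ⟶ C) (l : C ⟶ B) (r : A ⟶ D)
    (s : D ⟶ C) (n : D ⟶ B) (e : p ≫ l = 𝟙 B)
    (e₂ : a ≫ p = r ≫ s) (e₃ : s ≫ l = n) (e₄ : r ≫ n = a) (w : T.obj A)
    (t : ob (T.map a) w ⟶ ob (T.map n) (ob (T.map r) w))
    (h : t = (compCell T r n a e₄ w).inv) :
    (retractCell T p l e (ob (T.map a) w)).hom ≫ t =
      mp (T.map l) (sqCell T a p r s e₂ w).hom ≫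
        (compCell T s l n e₃ (ob (T.map r) w)).hom := by
  subst h
  rw [← cancel_mono (compCell T r n a e₄ w).hom]
  simp only [Category.assoc]
  rw [Iso.inv_hom_id, Category.comp_id, retractCell_after, compCell_comp_right, sqCell_comp_left]

/-- The compositor coherence behind the pentagon axiom. -/
theorem sqCell_pentagon {A B₁ B₂ B₃ C₁ C₂ C₃ C₄ E : Cat.{v, u}} (c : A ⟶ B₁) (b : B₁ ⟶ C₁)
    (a : C₁ ⟶ E) (ab : B₁ ⟶ C₂) (abc : A ⟶ B₂) (α₁ : C₂ ⟶ E) (α₂ : B₂ ⟶ C₂) (bc : A ⟶ B₃)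
    (α₃ : B₃ ⟶ C₁) (a' : B₃ ⟶ C₃) (α₃' : C₃ ⟶ E) (abc' : A ⟶ C₄) (α₄ : C₄ ⟶ C₃) (α₂' : B₂ ⟶ C₄)
    (α₂₄ : B₂ ⟶ C₃)
    (e₁ : b ≫ a = ab ≫ α₁) (e₂ : c ≫ ab = abc ≫ α₂) (e₃ : c ≫ b = bc ≫ α₃)
    (e₄ : α₃ ≫ a = a' ≫ α₃') (e₅ : bc ≫ a' = abc' ≫ α₄) (e₆ : abc ≫ α₂' = abc')
    (e₇ : α₂' ≫ α₄ = α₂₄) (e₈ : α₂₄ ≫ α₃' = α₂ ≫ α₁) (w : T.obj A)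
    (t₁ : ob (T.map a) (ob (T.map b) (ob (T.map c) w)) ⟶
      ob (T.map a) (ob (T.map α₃) (ob (T.map bc) w)))
    (h₁ : t₁ = mp (T.map a) (sqCell T c b bc α₃ e₃ w).hom)
    (t₂ : ob (T.map abc') w ⟶ ob (T.map α₂') (ob (T.map abc) w))
    (h₂ : t₂ = (compCell T abc α₂' abc' e₆ w).inv) :
    (sqCell T b a ab α₁ e₁ (ob (T.map c) w)).hom ≫
        mp (T.map α₁) (sqCell T c ab abc α₂ e₂ w).hom =
      t₁ ≫ (sqCell T α₃ a a' α₃' e₄ (ob (T.map bc) w)).hom ≫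
        mp (T.map α₃') (sqCell T bc a' abc' α₄ e₅ w).hom ≫
        mp (T.map α₃') (mp (T.map α₄) t₂) ≫
        mp (T.map α₃') (compCell T α₂' α₄ α₂₄ e₇ (ob (T.map abc) w)).hom ≫
        (sqCell T α₂₄ α₃' α₂ α₁ e₈ (ob (T.map abc) w)).hom := by
  subst h₁ h₂
  have e₉ : abc' ≫ α₄ = abc ≫ α₂₄ := by rw [← e₆, ← e₇]; rfl
  rw [← cancel_mono (compCell₃ T abc α₂ α₁ _ rfl w).hom]
  simp only [Category.assoc]
  rw [sqCell_comp_left, sqCell_comp_right, sqCell_comp_right, ← Category.assoc (mp _ (mp _ _)),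
    ← mp_comp, mp_compCell_inv_comp T abc α₂' α₄ abc' α₂₄ e₆ e₇ e₉, sqCell_comp_left,
    sqCell_comp_left, sqCell_comp_right, sqCell_comp_left]

end Calculus

/-! ### The canonical left strength of a pseudofunctor -/

section Strength

variable (T : Cat.{v, u} ⥤ᵖ Cat.{v, u})

/-- The isomorphism `T λ ∘ t ≅ λ` for the canonical strength, with components
`T λ (T ⟨i, -⟩ w) ≅ w`. -/
def canonicalX (A : Cat.{v, u}) : canonicalSt T one A ≫ T.map (lam A) ≅ lam (T.obj A) :=
  Cat.Hom.isoMk (NatIso.ofComponents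
    (F := (canonicalSt T one A ≫ T.map (lam A)).toFunctor) (G := (lam (T.obj A)).toFunctor)
    (fun p => retractCell T (pair p.1 A) (lam A) rfl p.2)
    (fun {p q} k => (congrArg (· ≫ _) (mp_comp _ _ _)).trans ((Category.assoc _ _ _).trans
      ((congrArg _ (retractCell_naturality T (pair q.1 A) (lam A) rfl k.2)).trans
        ((Category.assoc _ _ _).symm.trans (congrArg (· ≫ _)
          (retractCell_im T (pairMap k.1 A) (lam A) rfl rfl (fun _ => HEq.rfl) p.2)))))))

/-- The isomorphism `t ∘ (A × t) ≅ T α ∘ t` for the canonical strength, with components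
`T ⟨a, -⟩ (T ⟨b, -⟩ w) ≅ T α (T ⟨(a, b), -⟩ w)`. -/
def canonicalY (A B C : Cat.{v, u}) :
    assocHom A B (T.obj C) ≫ tensHom (𝟙 A) (canonicalSt T B C) ≫
        canonicalSt T A (tens B C) ≅
      canonicalSt T (tens A B) C ≫ T.map (assocHom A B C) :=
  Cat.Hom.isoMk (NatIso.ofComponents
    (F := (assocHom A B (T.obj C) ≫ tensHom (𝟙 A) (canonicalSt T B C) ≫
        canonicalSt T A (tens B C)).toFunctor)
    (G := (canonicalSt T (tens A B) C ≫ T.map (assocHom A B C)).toFunctor)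
    (fun p => sqCell T (pair p.1.2 C) (pair p.1.1 (tens B C)) (pair (A := tens A B) p.1 C)
          (assocHom A B C) rfl p.2)
    (fun k => sqCell_im_naturality T (pairMap k.1.2 C) (pairMap k.1.1 (tens B C))
      (pairMap (A := tens A B) k.1 C) (assocHom A B C) rfl rfl (fun _ => heq_of_eq (Prod.ext
        ((Category.id_comp _).trans (Category.comp_id _).symm) rfl)) k.2))

/-- The data of the canonical left strength: `t (a, w) = T ⟨a, -⟩ w`, with `x` and `y` given by the
compositors and the unitor. -/
def canonicalStrengthData : StrengthData T where
  t := canonicalTrans T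
  x := canonicalX T
  y := canonicalY T

theorem canonical_tmp_id {A B : Cat.{v, u}} (a : A) {w w' : T.obj B} (l : w ⟶ w') :
    (canonicalStrengthData T).tmp (𝟙 a) l = mp (T.map (pair a B)) l :=
  mp_canonicalSt_id T a l

theorem pair_comp_tensHom_id {A A' : Cat.{v, u}} (f : A ⟶ A') (B : Cat.{v, u}) (a : A) :
    pair a B ≫ tensHom f (𝟙 B) = pair (ob f a) B := (pair_natural f (𝟙 B) a).symm

/-- For the canonical strength, the unitor of `T` cancels in `tnatLeft`, which is therefore an
inverse compositor. -/
theorem canonical_tnatLeft {A A' : Cat.{v, u}} (f : A ⟶ A') (B : Cat.{v, u}) (a : A)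
    (w : T.obj B) :
    (canonicalStrengthData T).tnatLeft f B a w =
      (compCell T (pair a B) (tensHom f (𝟙 B)) (pair (ob f a) B)
        (pair_comp_tensHom_id f B a) w).inv := by
  refine (congrArg (· ≫ _) (canonical_tmp_id T _ _)).trans ?_
  change mp (T.map (pair (ob f a) B)) (idCell T B w).inv ≫
    (sqCell T (𝟙 B) (pair (ob f a) B) (pair a B) (tensHom f (𝟙 B))
      (pair_natural f (𝟙 B) a) w).hom = _
  rw [← cancel_mono (compCell T (pair a B) (tensHom f (𝟙 B)) (pair (ob f a) B)
      (pair_comp_tensHom_id f B a) w).hom,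
    Category.assoc, sqCell_hom_comp T (𝟙 B) (pair (ob f a) B) (pair a B) (tensHom f (𝟙 B))
      (pair_natural f (𝟙 B) a) _ (Category.id_comp _), compCell_id_comp, mp_inv_hom,
    Iso.inv_hom_id]

/-- The canonical left strength of a pseudofunctor. Each axiom is an instance of the coherence of
compositors, because the composites of the functors `⟨a, -⟩` with the structural 1-cells satisfy the
required strict equalities. -/
def canonicalStrength : LeftStrength T where
  toStrengthData := canonicalStrengthData T
  x_naturality {A A'} f i w :=
    retractCell_prism T (pair i A) (lam A) (pair i A') (lam A') f (tensHom (𝟙 one) f) rfl rfl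
      (pair_natural (𝟙 one) f i) rfl w
  y_naturality {A A' B B' C C'} f g h a b w :=
    (sqCell_cube T (pair b C) (pair a (tens B C)) (pair (A := tens A B) (a, b) C) (assocHom A B C)
      (pair (ob g b) C') (pair (ob f a) (tens B' C'))
      (pair (A := tens A' B') (ob f a, ob g b) C') (assocHom A' B' C') h (tensHom g h)
      (tensHom (tensHom f g) h) (tensHom f (tensHom g h)) rfl rfl (pair_natural g h b)
      (pair_natural f (tensHom g h) a) (pair_natural (A := tens A B) (tensHom f g) h (a, b))
      rfl w).trans (congrArg (· ≫ _) (canonical_tmp_id T _ _).symm)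
  middle_unit {A B} a i w :=
    retractCell_middle T (pair i B) (lam B) (pair a B) (pair a (tens one B)) (tensHom (𝟙 A) (lam B))
      (pair (A := tens A one) (a, i) B) (assocHom A one B) (tensHom (rho A) (𝟙 B)) rfl
      (pair_natural (𝟙 A) (lam B) a) rfl rfl
      (pair_comp_tensHom_id (A := tens A one) (rho A) B (a, i)) w _ (canonical_tmp_id T a _)
      _ (canonical_tnatLeft T (A := tens A one) (rho A) B (a, i) w)
  left_unit {A B} i a w :=
    retractCell_left T (pair a B) (pair i (tens A B)) (lam (tens A B))
      (pair (A := tens one A) (i, a) B) (assocHom one A B) (tensHom (lam A) (𝟙 B)) rfl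
      rfl rfl (pair_comp_tensHom_id (A := tens one A) (lam A) B (i, a)) w
      _ (canonical_tnatLeft T (A := tens one A) (lam A) B (i, a) w)
  pentagon {A B C D} a b c w :=
    sqCell_pentagon T (pair c D) (pair b (tens C D)) (pair a (tens B (tens C D)))
      (pair (A := tens A B) (a, b) (tens C D)) (pair (A := tens (tens A B) C) ((a, b), c) D)
      (assocHom A B (tens C D)) (assocHom (tens A B) C D) (pair (A := tens B C) (b, c) D)
      (assocHom B C D) (pair a (tens (tens B C) D)) (tensHom (𝟙 A) (assocHom B C D))
      (pair (A := tens A (tens B C)) (a, (b, c)) D) (assocHom A (tens B C) D)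
      (tensHom (assocHom A B C) (𝟙 D)) _ rfl rfl rfl (pair_natural (𝟙 A) (assocHom B C D) a) rfl
      (pair_comp_tensHom_id (A := tens (tens A B) C) (assocHom A B C) D ((a, b), c)) rfl rfl w
      _ (canonical_tmp_id T a _)
      _ (canonical_tnatLeft T (A := tens (tens A B) C) (assocHom A B C) D ((a, b), c) w)

theorem id_comp_comp_id {C : Type u} [Category.{v} C] {X Y : C} (f : X ⟶ Y) :
    f = 𝟙 X ≫ f ≫ 𝟙 Y := by
  rw [Category.id_comp, Category.comp_id]

theorem canonicalStrength_isCanonical : IsCanonical (canonicalStrength T).toStrengthData where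
  tob_eq _ _ := rfl
  tmp_eq {A B a a' w w'} k l := by
    change im T (pairMap k B) w ≫ mp (T.map (pair a' B)) l =
      𝟙 _ ≫ im T (pairMap k B) w ≫ mp (T.map (pair a' B)) l ≫ 𝟙 _
    rw [Category.id_comp, Category.comp_id]
  tnat_eq f g a w := id_comp_comp_id _
  x_eq A i w := (Category.id_comp _).symm
  y_eq C a b w := id_comp_comp_id _

end Strength

/-! ### Cancellation of identity morphisms -/

section Identities

variable {C : Type u} [Category.{v} C] {X X' Y Z P Q : C}

theorem comp_id_comp_id (f : X ⟶ Y) : f ≫ 𝟙 Y ≫ 𝟙 Y = f := by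
  rw [Category.comp_id, Category.comp_id]

theorem comp_id_comp_id_comp (f : X ⟶ Y) (g : Y ⟶ Z) (h : Z ⟶ P) :
    f ≫ 𝟙 Y ≫ g ≫ 𝟙 Z ≫ h = f ≫ g ≫ h := by
  rw [Category.id_comp, Category.id_comp]

/-- The form in which the composition law of a pseudonatural transformation appears in components,
with its identity morphisms removed and the compositors moved to the other side. -/
theorem comp_inv_of_comp_hom (i : Y ≅ Z) (n : X ⟶ Y) (m : X ⟶ X') (m' : X' ⟶ X)
    (hm : m' ≫ m = 𝟙 X') (f : X' ⟶ P) (g : P ⟶ Z)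
    (h : n ≫ i.hom = m ≫ 𝟙 X' ≫ f ≫ 𝟙 P ≫ g ≫ 𝟙 Z) : f ≫ g ≫ i.inv = m' ≫ n := by
  rw [comp_id_comp_id_comp, Category.comp_id] at h
  rw [← Category.assoc, Iso.comp_inv_eq, Category.assoc, h, reassoc_of% hm]

end Identities

/-! ### The unit and multiplication of a pseudomonad, in components -/

section MonadCalculus

variable (M : PseudomonadData Cat.{v, u}) {A B C D : Cat.{v, u}}

theorem etaNat_naturality (f : A ⟶ B) {a a' : A} (k : a ⟶ a') :
    mp (M.eta B) (mp f k) ≫ (cell (M.etaNat f) a').hom =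
      (cell (M.etaNat f) a).hom ≫ mp (M.T.map f) (mp (M.eta A) k) :=
  (M.etaNat f).hom.toNatTrans.naturality k

/-- The pseudonaturality of `η` is natural in the 1-cell. -/
theorem etaNat_im {f g : A ⟶ B} (σ : f ⟶ g) (a : A) :
    mp (M.eta B) (σ.toNatTrans.app a) ≫ (cell (M.etaNat g) a).hom =
      (cell (M.etaNat f) a).hom ≫ im M.T σ (ob (M.eta A) a) :=
  congrArg (fun τ => τ.toNatTrans.app a) (M.η.naturality_naturality σ)

theorem etaNat_id (a : A) :
    (cell (M.etaNat (𝟙 A)) a).hom ≫ (idCell M.T A (ob (M.eta A) a)).hom = 𝟙 _ := by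
  have h := congrArg (fun τ => τ.toNatTrans.app a) (M.η.naturality_id A)
  refine Eq.trans h ?_
  change mp (M.eta A) (𝟙 a) ≫ 𝟙 _ ≫ 𝟙 _ = _
  rw [mp_id, Category.comp_id]
  exact Category.comp_id _

/-- The pseudonaturality of `η` at a 1-cell equal to a composite. -/
theorem etaNat_comp (f : A ⟶ B) (g : B ⟶ C) (h : A ⟶ C) (e : f ≫ g = h) (a : A) :
    (cell (M.etaNat g) (ob f a)).hom ≫ mp (M.T.map g) (cell (M.etaNat f) a).hom ≫
        (compCell M.T f g h e (ob (M.eta A) a)).hom =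
      eqToHom (congrArg (fun k => ob (M.eta C) (ob k a)) e) ≫ (cell (M.etaNat h) a).hom := by
  subst e
  have h := congrArg (fun τ => τ.toNatTrans.app a) (M.η.naturality_comp f g)
  have h' : (cell (M.etaNat (f ≫ g)) a).hom ≫ (cell (M.T.mapComp f g) (ob (M.eta A) a)).hom =
      mp (M.eta C) (𝟙 _) ≫ 𝟙 _ ≫ (cell (M.etaNat g) (ob f a)).hom ≫ 𝟙 _ ≫
        mp (M.T.map g) (cell (M.etaNat f) a).hom ≫ 𝟙 _ := h
  rw [compCell_rfl]
  exact comp_inv_of_comp_hom (cell (M.T.mapComp f g) (ob (M.eta A) a)) _ (mp (M.eta C) (𝟙 _)) (𝟙 _)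
    ((Category.id_comp _).trans (mp_id _ _)) _ _ h'

theorem muNat_naturality (f : A ⟶ B) {W W' : M.T.obj (M.T.obj A)} (k : W ⟶ W') :
    mp (M.mu B) (mp (M.T.map (M.T.map f)) k) ≫ (cell (M.muNat f) W').hom =
      (cell (M.muNat f) W).hom ≫ mp (M.T.map f) (mp (M.mu A) k) :=
  (M.muNat f).hom.toNatTrans.naturality k

/-- The pseudonaturality of `μ` is natural in the 1-cell. -/
theorem muNat_im {f g : A ⟶ B} (σ : f ⟶ g) (W : M.T.obj (M.T.obj A)) :
    mp (M.mu B) (im M.T (M.T.map₂ σ) W) ≫ (cell (M.muNat g) W).hom =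
      (cell (M.muNat f) W).hom ≫ im M.T σ (ob (M.mu A) W) :=
  congrArg (fun τ => τ.toNatTrans.app W) (M.μ.naturality_naturality σ)

theorem muNat_id (W : M.T.obj (M.T.obj A)) :
    (cell (M.muNat (𝟙 A)) W).hom ≫ (idCell M.T A (ob (M.mu A) W)).hom =
      mp (M.mu A) (im M.T (M.T.mapId A).hom W ≫ (idCell M.T (M.T.obj A) W).hom) := by
  have h := congrArg (fun τ => τ.toNatTrans.app W) (M.μ.naturality_id A)
  exact h.trans (congrArg _ (Category.comp_id _) |>.trans (Category.comp_id _))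

/-- The component at `W` of the compositor of the pseudofunctor `T ∘ T`. -/
def compCellSq (T : Cat.{v, u} ⥤ᵖ Cat.{v, u}) (f : A ⟶ B) (g : B ⟶ C) (h : A ⟶ C) (e : f ≫ g = h)
    (W : T.obj (T.obj A)) :
    ob (T.map (T.map g)) (ob (T.map (T.map f)) W) ⟶ ob (T.map (T.map h)) W :=
  (compCell T (T.map f) (T.map g) _ rfl W).hom ≫ im T (T.mapComp' f g h e).inv W

/-- The pseudonaturality of `μ` at a 1-cell equal to a composite. -/
theorem muNat_comp (f : A ⟶ B) (g : B ⟶ C) (h : A ⟶ C) (e : f ≫ g = h)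
    (W : M.T.obj (M.T.obj A)) :
    (cell (M.muNat g) (ob (M.T.map (M.T.map f)) W)).hom ≫
        mp (M.T.map g) (cell (M.muNat f) W).hom ≫ (compCell M.T f g h e (ob (M.mu A) W)).hom =
      mp (M.mu C) (compCellSq M.T f g h e W) ≫ (cell (M.muNat h) W).hom := by
  subst e
  have h := congrArg (fun τ => τ.toNatTrans.app W) (M.μ.naturality_comp f g)
  have h' : (cell (M.muNat (f ≫ g)) W).hom ≫ (cell (M.T.mapComp f g) (ob (M.mu A) W)).hom =
      mp (M.mu C) (im M.T (M.T.mapComp f g).hom W ≫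
        (cell (M.T.mapComp (M.T.map f) (M.T.map g)) W).hom) ≫ 𝟙 _ ≫
      (cell (M.muNat g) (ob (M.T.map (M.T.map f)) W)).hom ≫ 𝟙 _ ≫
        mp (M.T.map g) (cell (M.muNat f) W).hom ≫ 𝟙 _ := h
  rw [compCell_rfl, compCellSq, compCell_rfl, M.T.mapComp'_eq_mapComp]
  refine comp_inv_of_comp_hom (cell (M.T.mapComp f g) (ob (M.mu A) W)) _ _ _ ?_ _ _ h'
  rw [← mp_comp, Iso.symm_hom]
  refine (congrArg _ ?_).trans (mp_id _ _)
  refine (Category.assoc _ _ _).trans ((congrArg _ ((Category.assoc _ _ _).symm.trans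
    ((congrArg (· ≫ _) ?_).trans (Category.id_comp _)))).trans (Iso.inv_hom_id _))
  rw [← im_comp, Iso.inv_hom_id, im_id]

end MonadCalculus

section Pseudomonad

variable (M : Pseudomonad Cat.{v, u}) {A B C D : Cat.{v, u}}

/-- The modification axiom for `n`, in components. -/
theorem cell_n_map (f : A ⟶ B) (v : M.T.obj A) :
    (cell (M.n B) (ob (M.T.map f) v)).hom =
      mp (M.mu B) (cell (M.etaNat (M.T.map f)) v).hom ≫
        (cell (M.muNat f) (ob (M.eta (M.T.obj A)) v)).hom ≫
        mp (M.T.map f) (cell (M.n A) v).hom := by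
  have h := congrArg (fun τ => τ.toNatTrans.app v) (M.n_naturality f)
  have h' : (cell (M.n B) (ob (M.T.map f) v)).hom ≫ 𝟙 _ ≫ 𝟙 _ = 𝟙 _ ≫
      mp (M.mu B) (cell (M.etaNat (M.T.map f)) v).hom ≫ 𝟙 _ ≫
        (cell (M.muNat f) (ob (M.eta (M.T.obj A)) v)).hom ≫ 𝟙 _ ≫
        mp (M.T.map f) (cell (M.n A) v).hom := h
  exact (comp_id_comp_id _).symm.trans (h'.trans ((Category.id_comp _).trans
    (comp_id_comp_id_comp _ _ _)))

/-- The modification axiom for `p`, in components. -/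
theorem cell_p_map (f : A ⟶ B) (v : M.T.obj A) :
    (cell (M.p B) (ob (M.T.map f) v)).hom =
      mp (M.mu B) (cell (Pseudo.mapSquare M.T (M.etaNat f)) v).hom ≫
        (cell (M.muNat f) (ob (M.T.map (M.eta A)) v)).hom ≫
        mp (M.T.map f) (cell (M.p A) v).hom := by
  have h := congrArg (fun τ => τ.toNatTrans.app v) (M.p_naturality f)
  have h' : (cell (M.p B) (ob (M.T.map f) v)).hom ≫ 𝟙 _ ≫ 𝟙 _ = 𝟙 _ ≫
      mp (M.mu B) (cell (Pseudo.mapSquare M.T (M.etaNat f)) v).hom ≫ 𝟙 _ ≫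
        (cell (M.muNat f) (ob (M.T.map (M.eta A)) v)).hom ≫ 𝟙 _ ≫
        mp (M.T.map f) (cell (M.p A) v).hom := h
  exact (comp_id_comp_id _).symm.trans (h'.trans ((Category.id_comp _).trans
    (comp_id_comp_id_comp _ _ _)))

/-- The modification axiom for `m`, in components. -/
theorem cell_m_map (f : A ⟶ B) (V : M.T.obj (M.T.obj (M.T.obj A))) :
    (cell (M.m B) (ob (M.T.map (M.T.map (M.T.map f))) V)).hom ≫
        mp (M.mu B) (cell (M.muNat (M.T.map f)) V).hom ≫
        (cell (M.muNat f) (ob (M.mu (M.T.obj A)) V)).hom =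
      mp (M.mu B) (cell (Pseudo.mapSquare M.T (M.muNat f)) V).hom ≫
        (cell (M.muNat f) (ob (M.T.map (M.mu A)) V)).hom ≫
        mp (M.T.map f) (cell (M.m A) V).hom := by
  have h := congrArg (fun τ => τ.toNatTrans.app V) (M.m_naturality f)
  have h' : (cell (M.m B) (ob (M.T.map (M.T.map (M.T.map f))) V)).hom ≫ 𝟙 _ ≫
        mp (M.mu B) (cell (M.muNat (M.T.map f)) V).hom ≫ 𝟙 _ ≫
        (cell (M.muNat f) (ob (M.mu (M.T.obj A)) V)).hom ≫ 𝟙 _ = 𝟙 _ ≫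
      mp (M.mu B) (cell (Pseudo.mapSquare M.T (M.muNat f)) V).hom ≫ 𝟙 _ ≫
        (cell (M.muNat f) (ob (M.T.map (M.mu A)) V)).hom ≫ 𝟙 _ ≫
        mp (M.T.map f) (cell (M.m A) V).hom := h
  refine Eq.trans (Eq.trans ?_ h') ((Category.id_comp _).trans (comp_id_comp_id_comp _ _ _))
  exact ((comp_id_comp_id_comp _ _ _).trans (congrArg _ (congrArg _ (Category.comp_id _)))).symm

end Pseudomonad

/-! ### Images of filled squares and triangles -/

section Calculus

variable (T : Cat.{v, u} ⥤ᵖ Cat.{v, u})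
variable {A : Cat.{v, u}}

theorem cell_mapSquare_hom {A' B B' C : Cat.{v, u}} {f : A' ⟶ B} {g : B ⟶ C} {h : A' ⟶ B'}
    {k : B' ⟶ C} (σ : f ≫ g ≅ h ≫ k) (v : T.obj A') :
    (cell (Pseudo.mapSquare T σ) v).hom =
      (compCell T f g _ rfl v).hom ≫ im T σ.hom v ≫ (compCell T h k _ rfl v).inv := by
  rw [compCell_rfl, compCell_rfl]
  rfl

/-- The image under `T` of a filled square, precomposed with a 1-cell `q`. The 2-cell `θ` is the
whiskering `q ◁ σ` up to strict equalities of 1-cells. -/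
theorem mapSquare_comp {A' B B' C : Cat.{v, u}} {f : A' ⟶ B} {g : B ⟶ C} {h : A' ⟶ B'}
    {k : B' ⟶ C} (σ : f ≫ g ≅ h ≫ k) (q : A ⟶ A') {x y : A ⟶ C} (θ : x ⟶ y)
    (e : q ≫ f ≫ g = x) (e' : q ≫ h ≫ k = y) (H : eqToHom e ≫ θ = q ◁ σ.hom ≫ eqToHom e')
    (W : T.obj A) :
    (cell (Pseudo.mapSquare T σ) (ob (T.map q) W)).hom ≫ (compCell₃ T q h k y e' W).hom =
      (compCell₃ T q f g x e W).hom ≫ im T θ W := by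
  rw [cell_mapSquare_hom, ← compCell_comp_right T q h k y _ rfl e',
    ← compCell_comp_right T q f g x _ rfl e,
    Category.assoc, Category.assoc, Iso.inv_hom_id_assoc, Category.assoc,
    im_whiskerLeft T q σ.hom θ e e' H]

/-- The image under `T` of a filled triangle, precomposed with a 1-cell `q`. The 2-cell `θ` is the
whiskering `q ◁ σ` up to strict equalities of 1-cells. -/
theorem mapTriangle_comp {A' B C : Cat.{v, u}} {f : A' ⟶ B} {g : B ⟶ C} {h : A' ⟶ C}
    (σ : f ≫ g ≅ h) (q : A ⟶ A') {x y : A ⟶ C} (θ : x ⟶ y)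
    (e : q ≫ f ≫ g = x) (e' : q ≫ h = y) (H : eqToHom e ≫ θ = q ◁ σ.hom ≫ eqToHom e')
    (W : T.obj A) :
    (cell ((T.mapComp f g).symm ≪≫ T.map₂Iso σ) (ob (T.map q) W)).hom ≫
        (compCell T q h y e' W).hom =
      (compCell₃ T q f g x e W).hom ≫ im T θ W := by
  have h1 : (cell ((T.mapComp f g).symm ≪≫ T.map₂Iso σ) (ob (T.map q) W)).hom =
      (compCell T f g _ rfl _).hom ≫ im T σ.hom _ := by
    rw [compCell_rfl]
    rfl
  rw [h1, ← compCell_comp_right T q f g x _ rfl e,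
    Category.assoc, Category.assoc, im_whiskerLeft T q σ.hom θ e e' H]

end Calculus

/-! ### The natural isomorphisms underlying `w` and `z` -/

section MonadCalculus

variable (M : PseudomonadData Cat.{v, u}) {A B C D : Cat.{v, u}}

/-- The inverse pseudonaturality of `η` is natural in the 1-cell and in the object; for the functors
`⟨a, -⟩` this is naturality of `z`. -/
theorem etaNat_inv_naturality {p p' : A ⟶ B} (σ : p ⟶ p') {a a' : A} (k : a ⟶ a') :
    (im M.T σ (ob (M.eta A) a) ≫ mp (M.T.map p') (mp (M.eta A) k)) ≫
        (cell (M.etaNat p') a').inv =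
      (cell (M.etaNat p) a).inv ≫ mp (M.eta B) (σ.toNatTrans.app a ≫ mp p' k) := by
  rw [Iso.comp_inv_eq, Category.assoc, Iso.eq_inv_comp, mp_comp, Category.assoc,
    etaNat_naturality, reassoc_of% (etaNat_im M σ a)]

/-- The component at `W` of the isomorphism `μ ∘ T s ∘ T q ≅ T p ∘ μ`, where `s ∘ q = T p`. For
`p = ⟨a, -⟩`, `q = ⟨a, -⟩` and `s = t` it is the component of `w` at `(a, W)`. -/
def mulCell {E : Cat.{v, u}} (q : M.T.obj A ⟶ E) (s : E ⟶ M.T.obj B) (p : A ⟶ B)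
    (e : q ≫ s = M.T.map p) (W : M.T.obj (M.T.obj A)) :
    ob (M.mu B) (ob (M.T.map s) (ob (M.T.map q) W)) ≅ ob (M.T.map p) (ob (M.mu A) W) :=
  (M.mu B).toFunctor.mapIso (compCell M.T q s (M.T.map p) e W) ≪≫ cell (M.muNat p) W

theorem mulCell_hom {E : Cat.{v, u}} (q : M.T.obj A ⟶ E) (s : E ⟶ M.T.obj B) (p : A ⟶ B)
    (e : q ≫ s = M.T.map p) (W : M.T.obj (M.T.obj A)) :
    (mulCell M q s p e W).hom =
      mp (M.mu B) (compCell M.T q s (M.T.map p) e W).hom ≫ (cell (M.muNat p) W).hom := rfl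

/-- `mulCell` is natural in `q`, `p` and in the object; for the functors `⟨a, -⟩` this is naturality
of `w`. -/
theorem mulCell_naturality {E : Cat.{v, u}} {q q' : M.T.obj A ⟶ E} (s : E ⟶ M.T.obj B)
    {p p' : A ⟶ B} (e : q ≫ s = M.T.map p) (e' : q' ≫ s = M.T.map p') (σ : q ⟶ q') (τ : p ⟶ p')
    (H : ∀ x, HEq ((M.T.map₂ τ).toNatTrans.app x) ((σ ▷ s).toNatTrans.app x))
    {W W' : M.T.obj (M.T.obj A)} (l : W ⟶ W') :
    mp (M.mu B) (mp (M.T.map s) (im M.T σ W ≫ mp (M.T.map q') l)) ≫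
        (mulCell M q' s p' e' W').hom =
      (mulCell M q s p e W).hom ≫ im M.T τ (ob (M.mu A) W) ≫
        mp (M.T.map p') (mp (M.mu A) l) := by
  have key : mp (M.T.map s) (im M.T σ W ≫ mp (M.T.map q') l) ≫
        (compCell M.T q' s (M.T.map p') e' W').hom =
      (compCell M.T q s (M.T.map p) e W).hom ≫ im M.T (M.T.map₂ τ) W ≫
        mp (M.T.map (M.T.map p')) l := by
    rw [mp_comp, Category.assoc, compCell_naturality,
      reassoc_of% (im_whiskerRight M.T σ s (M.T.map₂ τ) e e' (eqToHom_comp_eq _ _ _ _ H))]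
  rw [mulCell_hom, mulCell_hom, ← Category.assoc (mp (M.mu B) (mp _ _)), ← mp_comp, key, mp_comp,
    mp_comp, Category.assoc, Category.assoc, muNat_naturality, reassoc_of% (muNat_im M τ W),
    Category.assoc]

/-- `mulCell` is compatible with commutative squares; for the functors `⟨a, -⟩` this says that `w`
is a modification. -/
theorem mulCell_square {A A' E E' F F' : Cat.{v, u}} (g : A ⟶ A') (p : A ⟶ E) (p' : A' ⟶ E')
    (m : E ⟶ E') (q : M.T.obj A ⟶ F) (s : F ⟶ M.T.obj E) (q' : M.T.obj A' ⟶ F')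
    (s' : F' ⟶ M.T.obj E') (n : F ⟶ F') (e : g ≫ p' = p ≫ m) (e₁ : q ≫ s = M.T.map p)
    (e₂ : q' ≫ s' = M.T.map p') (e₃ : M.T.map g ≫ q' = q ≫ n) (ν : n ≫ s' ≅ s ≫ M.T.map m)
    (H : ∀ x, HEq (((M.T.mapComp' g p' (p ≫ m) e).inv ≫
      (M.T.mapComp' p m (p ≫ m) rfl).hom).toNatTrans.app x) ((q ◁ ν.hom).toNatTrans.app x))
    (W : M.T.obj (M.T.obj A))
    (t : ob (M.T.map p') (ob (M.mu A') (ob (M.T.map (M.T.map g)) W)) ⟶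
      ob (M.T.map p') (ob (M.T.map g) (ob (M.mu A) W)))
    (h : t = mp (M.T.map p') (cell (M.muNat g) W).hom) :
    (mulCell M q' s' p' e₂ (ob (M.T.map (M.T.map g)) W)).hom ≫ t ≫
        (sqCell M.T g p' p m e (ob (M.mu A) W)).hom =
      mp (M.mu E') (mp (M.T.map s') (sqCell M.T (M.T.map g) q' q n e₃ W).hom) ≫
        mp (M.mu E') (cell (Pseudo.mapSquare M.T ν) (ob (M.T.map q) W)).hom ≫
        (cell (M.muNat m) (ob (M.T.map s) (ob (M.T.map q) W))).hom ≫
        mp (M.T.map m) (mulCell M q s p e₁ W).hom := by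
  subst h
  have e₄ : q ≫ n ≫ s' = M.T.map g ≫ M.T.map p' := by
    rw [← Category.assoc, ← e₃, Category.assoc, e₂]
  have e₅ : q ≫ s ≫ M.T.map m = M.T.map p ≫ M.T.map m := by rw [← Category.assoc, e₁]
  -- The two ways of identifying `T s' ∘ T q' ∘ T (T g)` with `T (T (m ∘ p))` agree.
  have key : (compCell M.T q' s' (M.T.map p') e₂ (ob (M.T.map (M.T.map g)) W)).hom ≫
        compCellSq M.T g p' (p ≫ m) e W =
      mp (M.T.map s') (sqCell M.T (M.T.map g) q' q n e₃ W).hom ≫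
        (cell (Pseudo.mapSquare M.T ν) (ob (M.T.map q) W)).hom ≫
        mp (M.T.map (M.T.map m)) (compCell M.T q s (M.T.map p) e₁ W).hom ≫
        compCellSq M.T p m (p ≫ m) rfl W := by
    have h1 := mapSquare_comp M.T ν q _ e₄ e₅ (eqToHom_comp_eq _ _ _ _ H) W
    rw [compCellSq, compCellSq, reassoc_of% (compCell_comp_right M.T),
      reassoc_of% (compCell_comp_left M.T), reassoc_of% h1, reassoc_of% (sqCell_comp_left M.T),
      ← im_comp,
      Category.assoc, Iso.hom_inv_id, Category.comp_id]
  rw [← cancel_mono (compCell M.T p m _ rfl (ob (M.mu A) W)).hom]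
  simp only [Category.assoc]
  rw [sqCell_hom_comp M.T g p' p m e _ e rfl, mulCell_hom, mulCell_hom, mp_comp, Category.assoc,
    muNat_comp, Category.assoc, ← reassoc_of% (muNat_naturality M m), muNat_comp]
  simp only [← Category.assoc, ← mp_comp]
  rw [key]
  simp only [Category.assoc]

end MonadCalculus

/-! ### The isomorphisms `w` and `z` of the canonical strength -/

section Strength

variable (M : Pseudomonad Cat.{v, u})

/-- `t ∘ ⟨a, -⟩ = T ⟨a, -⟩`, the strict equality on which the construction of `w` rests. -/
theorem pair_canonicalSt (T : Cat.{v, u} ⥤ᵖ Cat.{v, u}) {A : Cat.{v, u}} (a : A) (B : Cat.{v, u}) :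
    pair a (T.obj B) ≫ canonicalSt T A B = T.map (pair a B) :=
  (canonicalStrength_isCanonical T).pair_st a B

/-- The isomorphism `μ ∘ T t ∘ t ≅ t ∘ (A × μ)` for the canonical strength: a compositor followed by
the pseudonaturality of `μ` at `⟨a, -⟩`. -/
def canonicalW (A B : Cat.{v, u}) :
    canonicalSt M.T A (M.T.obj B) ≫ M.T.map (canonicalSt M.T A B) ≫ M.mu (tens A B) ≅
      tensHom (𝟙 A) (M.mu B) ≫ canonicalSt M.T A B :=
  Cat.Hom.isoMk (NatIso.ofComponents
    (F := (canonicalSt M.T A (M.T.obj B) ≫ M.T.map (canonicalSt M.T A B) ≫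
      M.mu (tens A B)).toFunctor)
    (G := (tensHom (𝟙 A) (M.mu B) ≫ canonicalSt M.T A B).toFunctor)
    (fun p => mulCell M.toPseudomonadData (pair p.1 (M.T.obj B)) (canonicalSt M.T A B)
      (pair p.1 B) (pair_canonicalSt M.T p.1 B) p.2)
    (fun k => mulCell_naturality M.toPseudomonadData (canonicalSt M.T A B) _ _
      (pairMap k.1 (M.T.obj B)) (pairMap k.1 B) (fun _ => heq_of_eq
        ((congrArg _ (mp_id _ _)).trans (Category.comp_id _)).symm) k.2))

/-- The isomorphism `t ∘ (A × η) ≅ η` for the canonical strength: the inverse of the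
pseudonaturality of `η` at `⟨a, -⟩`. -/
def canonicalZ (A B : Cat.{v, u}) :
    tensHom (𝟙 A) (M.eta B) ≫ canonicalSt M.T A B ≅ M.eta (tens A B) :=
  Cat.Hom.isoMk (NatIso.ofComponents
    (F := (tensHom (𝟙 A) (M.eta B) ≫ canonicalSt M.T A B).toFunctor)
    (G := (M.eta (tens A B)).toFunctor)
    (fun p => (cell (M.etaNat (pair p.1 B)) p.2).symm)
    (fun k => (etaNat_inv_naturality M.toPseudomonadData (pairMap k.1 B) k.2).trans
      (congrArg _ (congrArg (mp (M.eta (tens A B)))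
        (Prod.ext (Category.comp_id _) (Category.id_comp _))))))

end Strength

/-! ### Compatibility of the unit and multiplication with compositors -/

section MonadCalculus

variable (M : PseudomonadData Cat.{v, u})

/-- The inverse form of `etaNat_comp`. -/
theorem etaNat_comp_inv {A B C : Cat.{v, u}} (f : A ⟶ B) (g : B ⟶ C) (h : A ⟶ C) (e : f ≫ g = h)
    (a : A) :
    mp (M.T.map g) (cell (M.etaNat f) a).inv ≫ (cell (M.etaNat g) (ob f a)).inv ≫
        eqToHom (congrArg (fun k => ob (M.eta C) (ob k a)) e) =
      (compCell M.T f g h e (ob (M.eta A) a)).hom ≫ (cell (M.etaNat h) a).inv := by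
  rw [Iso.eq_comp_inv, Category.assoc, Category.assoc, ← etaNat_comp M f g h e,
    Iso.inv_hom_id_assoc,
    reassoc_of% (mp_inv_hom (M.T.map g) (cell (M.etaNat f) a))]

/-- Pseudonaturality of `η` along a commutative square; for the functors `⟨a, -⟩` this says that `z`
is a modification. -/
theorem etaNat_square {A A' B B' : Cat.{v, u}} (g : A ⟶ A') (p' : A' ⟶ B') (p : A ⟶ B)
    (m : B ⟶ B') (e : g ≫ p' = p ≫ m) (a : A)
    (t : ob (M.T.map p') (ob (M.eta A') (ob g a)) ⟶
      ob (M.T.map p') (ob (M.T.map g) (ob (M.eta A) a)))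
    (h : t = mp (M.T.map p') (cell (M.etaNat g) a).hom) :
    (cell (M.etaNat p') (ob g a)).inv ≫
        eqToHom (congrArg (fun k => ob (M.eta B') (ob k a)) e) ≫ (cell (M.etaNat m) (ob p a)).hom =
      t ≫ (sqCell M.T g p' p m e (ob (M.eta A) a)).hom ≫
        mp (M.T.map m) (cell (M.etaNat p) a).inv := by
  subst h
  have h1 := etaNat_comp_inv M g p' (p ≫ m) e a
  have h2 := etaNat_comp_inv M p m (p ≫ m) rfl a
  rw [eqToHom_refl, Category.comp_id, ← Iso.inv_comp_eq] at h2
  rw [sqCell_hom, Category.assoc, ← cancel_mono (cell (M.etaNat m) (ob p a)).inv]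
  simp only [Category.assoc]
  rw [Iso.hom_inv_id, Category.comp_id, h2, ← h1,
    reassoc_of% (mp_hom_inv (M.T.map p') (cell (M.etaNat g) a))]

/-- Inverse pseudonaturality of `η` along a commutative square; for the functors `⟨a, -⟩` this
relates `y` to `z`. -/
theorem etaNat_inv_square {A A' B B' : Cat.{v, u}} (g : A ⟶ A') (p' : A' ⟶ B') (p : A ⟶ B)
    (m : B ⟶ B') (e : g ≫ p' = p ≫ m) (a : A)
    (t : ob (M.T.map p') (ob (M.T.map g) (ob (M.eta A) a)) ⟶
      ob (M.T.map p') (ob (M.eta A') (ob g a)))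
    (h : t = mp (M.T.map p') (cell (M.etaNat g) a).inv) :
    t ≫ (cell (M.etaNat p') (ob g a)).inv =
      (sqCell M.T g p' p m e (ob (M.eta A) a)).hom ≫
        mp (M.T.map m) (cell (M.etaNat p) a).inv ≫ (cell (M.etaNat m) (ob p a)).inv ≫
        eqToHom (congrArg (fun k => ob (M.eta B') (ob k a)) e.symm) := by
  subst h
  have h1 := etaNat_comp_inv M g p' (p ≫ m) e a
  have h2 := etaNat_comp_inv M p m (p ≫ m) rfl a
  rw [eqToHom_refl, Category.comp_id] at h2
  rw [sqCell_hom, Category.assoc, reassoc_of% h2, Iso.inv_hom_id_assoc, ← reassoc_of% h1,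
    eqToHom_trans, eqToHom_refl, Category.comp_id]

/-- Pseudonaturality of `η` along a retraction; for the functors `⟨i, -⟩` and `λ` this relates `x`
to `z`. -/
theorem etaNat_retract {A B : Cat.{v, u}} (p : A ⟶ B) (l : B ⟶ A) (e : p ≫ l = 𝟙 A) (a : A) :
    mp (M.T.map l) (cell (M.etaNat p) a).inv ≫ (cell (M.etaNat l) (ob p a)).inv ≫
        eqToHom (congrArg (fun k => ob (M.eta A) (ob k a)) e) =
      (retractCell M.T p l e (ob (M.eta A) a)).hom := by
  rw [etaNat_comp_inv M p l (𝟙 A) e, retractCell, Iso.trans_hom]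
  exact congrArg _ (Iso.inv_ext (etaNat_id M a))

/-- `mulCell` along a retraction `l` of `p`; for the functors `⟨i, -⟩` and `λ` this relates `x` to
`w`. -/
theorem mulCell_retract {A E F : Cat.{v, u}} (p : A ⟶ E) (l : E ⟶ A) (q : M.T.obj A ⟶ F)
    (s : F ⟶ M.T.obj E) (l' : F ⟶ M.T.obj A) (e : p ≫ l = 𝟙 A) (e₁ : q ≫ s = M.T.map p)
    (e₂ : q ≫ l' = 𝟙 (M.T.obj A)) (ξ : s ≫ M.T.map l ≅ l')
    (H : ∀ x, HEq (((M.T.mapComp' p l (𝟙 A) e).inv ≫ (M.T.mapId A).hom).toNatTrans.app x)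
      ((q ◁ ξ.hom).toNatTrans.app x)) (W : M.T.obj (M.T.obj A)) :
    mp (M.mu A) (cell ((M.T.mapComp s (M.T.map l)).symm ≪≫ M.T.map₂Iso ξ) (ob (M.T.map q) W)).hom ≫
        mp (M.mu A) (retractCell M.T q l' e₂ W).hom =
      (cell (M.muNat l) (ob (M.T.map s) (ob (M.T.map q) W))).hom ≫
        mp (M.T.map l) (mulCell M q s p e₁ W).hom ≫
        (retractCell M.T p l e (ob (M.mu A) W)).hom := by
  have e₃ : q ≫ s ≫ M.T.map l = M.T.map p ≫ M.T.map l := by rw [← Category.assoc, e₁]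
  have h1 := mapTriangle_comp M.T ξ q _ e₃ e₂ (eqToHom_comp_eq _ _ _ _ H) W
  rw [mulCell_hom, mp_comp, retractCell, retractCell, Iso.trans_hom, Iso.trans_hom, Category.assoc,
    ← reassoc_of% (muNat_naturality M l), reassoc_of% (muNat_comp M p l (𝟙 A) e W), muNat_id]
  simp only [← mp_comp]
  rw [reassoc_of% h1, compCellSq, im_comp, Category.assoc, Category.assoc,
    reassoc_of% (compCell_comp_left M.T)]

/-- `mulCell` along a composite `pa ∘ pb = α ∘ pab`; for the functors `⟨a, -⟩`, `⟨b, -⟩` and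
`⟨(a, b), -⟩` this relates `y` to `w`. After the pseudonaturality squares of `μ` are pasted, both
sides are `μ` of a coherence of compositors, followed by the pseudonaturality of `μ` at
`α ∘ pab`. -/
theorem mulCell_assoc {A E₁ E₂ E₃ F₁ F₂ F₃ G₂ : Cat.{v, u}} (pb : A ⟶ E₁) (pa : E₁ ⟶ E₃)
    (pab : A ⟶ E₂) (α : E₂ ⟶ E₃) (e : pb ≫ pa = pab ≫ α)
    (qb : M.T.obj A ⟶ F₁) (sb : F₁ ⟶ M.T.obj E₁) (e₁ : qb ≫ sb = M.T.map pb)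
    (qa : M.T.obj E₁ ⟶ F₃) (sa : F₃ ⟶ M.T.obj E₃) (e₂ : qa ≫ sa = M.T.map pa)
    (qab : M.T.obj A ⟶ F₂) (sab : F₂ ⟶ M.T.obj E₂) (e₃ : qab ≫ sab = M.T.map pab)
    (qa' : F₁ ⟶ G₂) (c : G₂ ⟶ F₃) (e₄ : sb ≫ qa = qa' ≫ c) (α' : F₂ ⟶ G₂)
    (e₅ : qb ≫ qa' = qab ≫ α') (υ : α' ≫ c ≫ sa ≅ sab ≫ M.T.map α)
    (H : ∀ x, HEq (((M.T.mapComp' pb pa (pab ≫ α) e).inv ≫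
      (M.T.mapComp' pab α (pab ≫ α) rfl).hom).toNatTrans.app x) ((qab ◁ υ.hom).toNatTrans.app x))
    (W : M.T.obj (M.T.obj A))
    (t : ob (M.T.map pa) (ob (M.mu E₁) (ob (M.T.map sb) (ob (M.T.map qb) W))) ⟶
      ob (M.T.map pa) (ob (M.T.map pb) (ob (M.mu A) W)))
    (h : t = mp (M.T.map pa) (mulCell M qb sb pb e₁ W).hom) :
    mp (M.mu E₃) (mp (M.T.map sa) (sqCell M.T sb qa qa' c e₄ (ob (M.T.map qb) W)).hom) ≫
        mp (M.mu E₃) (mp (M.T.map sa) (mp (M.T.map c) (sqCell M.T qb qa' qab α' e₅ W).hom)) ≫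
        mp (M.mu E₃) (compCell M.T c sa _ rfl (ob (M.T.map α') (ob (M.T.map qab) W)) ≪≫
          cell (Pseudo.mapSquare M.T υ) (ob (M.T.map qab) W)).hom ≫
        (cell (M.muNat α) (ob (M.T.map sab) (ob (M.T.map qab) W))).hom ≫
        mp (M.T.map α) (mulCell M qab sab pab e₃ W).hom =
      (mulCell M qa sa pa e₂ (ob (M.T.map sb) (ob (M.T.map qb) W))).hom ≫ t ≫
        (sqCell M.T pb pa pab α e (ob (M.mu A) W)).hom := by
  subst h
  have e₆ : qab ≫ α' ≫ c ≫ sa = M.T.map pb ≫ M.T.map pa := by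
    rw [← Category.assoc, ← e₅, ← e₁, ← e₂]
    change qb ≫ (qa' ≫ c) ≫ sa = qb ≫ (sb ≫ qa) ≫ sa
    rw [e₄]
  have e₇ : qab ≫ sab ≫ M.T.map α = M.T.map pab ≫ M.T.map α := by rw [← Category.assoc, e₃]
  have e₈ : qa' ≫ c ≫ sa = sb ≫ M.T.map pa := by
    rw [← Category.assoc, ← e₄, Category.assoc, e₂]
  have e₉ : qb ≫ sb ≫ M.T.map pa = M.T.map pb ≫ M.T.map pa := by rw [← Category.assoc, e₁]
  have h1 := mapSquare_comp M.T υ qab _ e₆ e₇ (eqToHom_comp_eq _ _ _ _ H) W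
  -- The two ways of identifying `T sa ∘ T qa ∘ T sb ∘ T qb` with `T (T (α ∘ pab))` agree.
  have key : mp (M.T.map sa) (sqCell M.T sb qa qa' c e₄ (ob (M.T.map qb) W)).hom ≫
        mp (M.T.map sa) (mp (M.T.map c) (sqCell M.T qb qa' qab α' e₅ W).hom) ≫
        ((compCell M.T c sa _ rfl (ob (M.T.map α') (ob (M.T.map qab) W))).hom ≫
          (cell (Pseudo.mapSquare M.T υ) (ob (M.T.map qab) W)).hom) ≫
        mp (M.T.map (M.T.map α)) (compCell M.T qab sab (M.T.map pab) e₃ W).hom ≫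
        compCellSq M.T pab α (pab ≫ α) rfl W =
      (compCell M.T qa sa (M.T.map pa) e₂ (ob (M.T.map sb) (ob (M.T.map qb) W))).hom ≫
        mp (M.T.map (M.T.map pa)) (compCell M.T qb sb (M.T.map pb) e₁ W).hom ≫
        compCellSq M.T pb pa (pab ≫ α) e W := by
    rw [compCellSq, compCellSq, reassoc_of% (compCell_comp_left M.T),
      reassoc_of% (compCell_comp_left M.T), Category.assoc, reassoc_of% h1, ← im_comp,
      Category.assoc, Iso.hom_inv_id, Category.comp_id,
      reassoc_of% (compCell_naturality M.T c sa _ rfl (sqCell M.T qb qa' qab α' e₅ W).hom),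
      reassoc_of% (sqCell_comp_left M.T),
      ← compCell_comp_right M.T qb qa' (c ≫ sa) _ _ e₈ e₉,
      ← compCell_comp_right M.T qb sb (M.T.map pa) _ _ rfl e₉]
    simp only [Category.assoc]
    rw [reassoc_of% (compCell_comp_right M.T sb qa sa),
      ← reassoc_of% (sqCell_comp_left M.T sb qa qa' c sa (sb ≫ M.T.map pa) e₄ e₈),
      reassoc_of% (compCell_comp_right M.T qa' c sa)]
  rw [← cancel_mono (compCell M.T pab α _ rfl (ob (M.mu A) W)).hom]
  simp only [Category.assoc]
  rw [sqCell_hom_comp M.T pb pa pab α e _ e rfl, mulCell_hom, mulCell_hom, mulCell_hom, mp_comp,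
    mp_comp]
  simp only [Category.assoc]
  rw [← reassoc_of% (muNat_naturality M α), muNat_comp, ← reassoc_of% (muNat_naturality M pa),
    muNat_comp, Iso.trans_hom]
  have key' := congrArg (fun k => mp (M.mu E₃) k ≫ (cell (M.muNat (pab ≫ α)) W).hom) key
  simpa only [mp_comp, Category.assoc] using key'

end MonadCalculus

/-! ### Compatibility with the modifications of a pseudomonad -/

section Pseudomonad

variable (M : Pseudomonad Cat.{v, u})

theorem cell_m_naturality {A : Cat.{v, u}} {V V' : M.T.obj (M.T.obj (M.T.obj A))} (k : V ⟶ V') :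
    mp (M.mu A) (mp (M.T.map (M.mu A)) k) ≫ (cell (M.m A) V').hom =
      (cell (M.m A) V).hom ≫ mp (M.mu A) (mp (M.mu (M.T.obj A)) k) :=
  (M.m A).hom.toNatTrans.naturality k

/-- Compatibility of `mulCell` with `n`: the modification axiom for `n` at `p`, where the
pseudonaturality of `η` at `T p = s ∘ q` splits into those at `q` and `s`. -/
theorem mulCell_n {A E F : Cat.{v, u}} (p : A ⟶ E) (q : M.T.obj A ⟶ F) (s : F ⟶ M.T.obj E)
    (e : q ≫ s = M.T.map p) (v : M.T.obj A)
    (t : ob (M.T.map p) (ob (M.mu A) (ob (M.eta (M.T.obj A)) v)) ⟶ ob (M.T.map p) v)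
    (h : t = mp (M.T.map p) (cell (M.n A) v).hom) :
    (mulCell M.toPseudomonadData q s p e (ob (M.eta (M.T.obj A)) v)).hom ≫ t =
      mp (M.mu E) (mp (M.T.map s) (cell (M.etaNat q) v).inv) ≫
        mp (M.mu E) (cell (M.etaNat s) (ob q v)).inv ≫
        eqToHom (congrArg (fun k => ob (M.mu E) (ob (M.eta (M.T.obj E)) (ob k v))) e) ≫
        (cell (M.n E) (ob (M.T.map p) v)).hom := by
  subst h
  have h1 : eqToHom (congrArg (fun k => ob (M.mu E) (ob (M.eta (M.T.obj E)) (ob k v))) e) =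
      mp (M.mu E) (eqToHom (congrArg (fun k => ob (M.eta (M.T.obj E)) (ob k v)) e)) :=
    (eqToHom_map (M.mu E).toFunctor _).symm
  have h2 := etaNat_comp_inv M.toPseudomonadData q s (M.T.map p) e v
  rw [cell_n_map, h1, mulCell_hom, Category.assoc]
  simp only [← Category.assoc, ← mp_comp]
  simp only [Category.assoc]
  rw [reassoc_of% h2, Iso.inv_hom_id, Category.comp_id]

/-- Compatibility of `mulCell` with `p`: the modification axiom for `p` at the 1-cell `p`, where the
triangle `ζ` restricts along `p` to the inverse pseudonaturality of `η`. -/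
theorem mulCell_p {A E F : Cat.{v, u}} (p : A ⟶ E) (q : M.T.obj A ⟶ F) (s : F ⟶ M.T.obj E)
    (e : q ≫ s = M.T.map p) (c : E ⟶ F) (e₁ : M.eta A ≫ q = p ≫ c) (ζ : c ≫ s ≅ M.eta E)
    (H : ∀ x, HEq ((M.etaNat p).inv.toNatTrans.app x) ((p ◁ ζ.hom).toNatTrans.app x))
    (v : M.T.obj A)
    (t : ob (M.T.map p) (ob (M.mu A) (ob (M.T.map (M.eta A)) v)) ⟶ ob (M.T.map p) v)
    (h : t = mp (M.T.map p) (cell (M.p A) v).hom) :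
    (mulCell M.toPseudomonadData q s p e (ob (M.T.map (M.eta A)) v)).hom ≫ t =
      mp (M.mu E) (mp (M.T.map s) (sqCell M.T (M.eta A) q p c e₁ v).hom) ≫
        mp (M.mu E) (cell ((M.T.mapComp c s).symm ≪≫ M.T.map₂Iso ζ) (ob (M.T.map p) v)).hom ≫
        (cell (M.p E) (ob (M.T.map p) v)).hom := by
  subst h
  have e₂ : p ≫ c ≫ s = M.eta A ≫ M.T.map p := by
    rw [← Category.assoc, ← e₁, Category.assoc, e]
  have h1 := mapTriangle_comp M.T ζ p _ e₂ rfl (eqToHom_comp_eq _ _ _ _ H) v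
  -- The image of `ζ` cancels the image of the pseudonaturality of `η`, leaving compositors.
  have key : (compCell M.T q s (M.T.map p) e (ob (M.T.map (M.eta A)) v)).hom =
      mp (M.T.map s) (sqCell M.T (M.eta A) q p c e₁ v).hom ≫
        (cell ((M.T.mapComp c s).symm ≪≫ M.T.map₂Iso ζ) (ob (M.T.map p) v)).hom ≫
        (cell (Pseudo.mapSquare M.T (M.etaNat p)) v).hom := by
    rw [cell_mapSquare_hom, reassoc_of% h1, ← Category.assoc (im _ _ _), ← im_comp, Iso.inv_hom_id,
      im_id, Category.id_comp, reassoc_of% (sqCell_comp_left M.T), Iso.eq_comp_inv,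
      compCell_comp_right]
  rw [cell_p_map, mulCell_hom, key, Category.assoc]
  simp only [← Category.assoc, ← mp_comp]

/-- Compatibility of `mulCell` with `m`: the modification axiom for `m` at `p`, where `ω` restricts
along `r` to the pseudonaturality of `μ` at `p`. -/
theorem mulCell_m {A E F G : Cat.{v, u}} (p : A ⟶ E) (q : M.T.obj A ⟶ F) (s : F ⟶ M.T.obj E)
    (e : q ≫ s = M.T.map p) (r : M.T.obj (M.T.obj A) ⟶ G) (s₁ : G ⟶ M.T.obj F)
    (e₁ : r ≫ s₁ = M.T.map q) (c : G ⟶ F) (e₂ : M.mu A ≫ q = r ≫ c)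
    (ω : s₁ ≫ M.T.map s ≫ M.mu E ≅ c ≫ s)
    (H : ∀ x, HEq (((M.T.mapComp' q s (M.T.map p) e).inv ▷ M.mu E ≫
      (M.muNat p).hom).toNatTrans.app x) ((r ◁ ω.hom).toNatTrans.app x))
    (V : M.T.obj (M.T.obj (M.T.obj A)))
    (t : ob (M.T.map p) (ob (M.mu A) (ob (M.T.map (M.mu A)) V)) ⟶
      ob (M.T.map p) (ob (M.mu A) (ob (M.mu (M.T.obj A)) V)))
    (h : t = mp (M.T.map p) (cell (M.m A) V).hom) :
    (cell (M.m E) (ob (M.T.map (M.T.map s)) (ob (M.T.map s₁) (ob (M.T.map r) V)))).hom ≫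
        mp (M.mu E) (cell (M.muNat s) (ob (M.T.map s₁) (ob (M.T.map r) V))).hom ≫
        mp (M.mu E) (mp (M.T.map s) (mulCell M.toPseudomonadData r s₁ q e₁ V).hom) ≫
        (mulCell M.toPseudomonadData q s p e (ob (M.mu (M.T.obj A)) V)).hom =
      mp (M.mu E) (compCell M.T (M.T.map s) (M.mu E) _ rfl (ob (M.T.map s₁) (ob (M.T.map r) V)) ≪≫
          cell (Pseudo.mapSquare M.T ω) (ob (M.T.map r) V)).hom ≫
        mp (M.mu E) (mp (M.T.map s) (sqCell M.T (M.mu A) q r c e₂ V).inv) ≫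
        (mulCell M.toPseudomonadData q s p e (ob (M.T.map (M.mu A)) V)).hom ≫ t := by
  subst h
  have e₃ : r ≫ s₁ ≫ M.T.map s ≫ M.mu E = (M.T.map q ≫ M.T.map s) ≫ M.mu E := by
    rw [← Category.assoc, e₁, Category.assoc]
  have e₄ : r ≫ c ≫ s = M.mu A ≫ M.T.map p := by
    rw [← Category.assoc, ← e₂, Category.assoc, e]
  have h1 := mapSquare_comp M.T ω r _ e₃ e₄ (eqToHom_comp_eq _ _ _ _ H) V
  have h2 : mp (M.T.map s) (sqCell M.T (M.mu A) q r c e₂ V).inv ≫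
      (compCell₃ M.T (M.mu A) q s _ (congrArg (M.mu A ≫ ·) e) V).hom =
      (compCell₃ M.T r c s _ e₄ V).hom := by
    rw [← sqCell_comp_left M.T (M.mu A) q r c s _ e₂ e₄, ← Category.assoc, ← mp_comp,
      Iso.inv_hom_id, mp_id, Category.id_comp]
  -- The two ways of identifying `T μ ∘ T (T s) ∘ T s₁ ∘ T r` with `T (T p) ∘ T μ` agree.
  have key : mp (M.T.map (M.mu E)) (mp (M.T.map (M.T.map s))
        (compCell M.T r s₁ (M.T.map q) e₁ V).hom ≫ compCellSq M.T q s (M.T.map p) e V) ≫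
        (cell (Pseudo.mapSquare M.T (M.muNat p)) V).hom =
      (compCell M.T (M.T.map s) (M.mu E) _ rfl (ob (M.T.map s₁) (ob (M.T.map r) V)) ≪≫
          cell (Pseudo.mapSquare M.T ω) (ob (M.T.map r) V)).hom ≫
        mp (M.T.map s) (sqCell M.T (M.mu A) q r c e₂ V).inv ≫
        (compCell M.T q s (M.T.map p) e (ob (M.T.map (M.mu A)) V)).hom := by
    rw [cell_mapSquare_hom, ← cancel_mono (compCell M.T (M.mu A) (M.T.map p) _ rfl V).hom]
    simp only [Category.assoc]
    rw [Iso.inv_hom_id, Category.comp_id, compCell_comp_right, h2, Iso.trans_hom, Category.assoc,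
      h1, compCellSq, mp_comp, mp_comp, Category.assoc, Category.assoc,
      reassoc_of% (im_whiskerRight M.T (M.T.mapComp' q s (M.T.map p) e).inv (M.mu E)
        ((M.T.mapComp' q s (M.T.map p) e).inv ▷ M.mu E) rfl rfl (by simp)),
      reassoc_of% (compCell_comp_left M.T), ← im_comp,
      ← compCell_comp_right M.T (M.T.map q) (M.T.map s) (M.mu E)
        ((M.T.map q ≫ M.T.map s) ≫ M.mu E) _ rfl rfl,
      Category.assoc,
      reassoc_of% (compCell_naturality M.T (M.T.map s) (M.mu E) _ rfl),
      reassoc_of% (compCell_comp_left M.T)]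
  -- The pseudonaturality of `μ` at `q` and `s` pastes to that at `T p = s ∘ q`.
  have h3 : (cell (M.muNat s) (ob (M.T.map s₁) (ob (M.T.map r) V))).hom ≫
        mp (M.T.map s) (mulCell M.toPseudomonadData r s₁ q e₁ V).hom ≫
        (compCell M.T q s (M.T.map p) e (ob (M.mu (M.T.obj A)) V)).hom =
      mp (M.mu (M.T.obj E)) (mp (M.T.map (M.T.map s))
        (compCell M.T r s₁ (M.T.map q) e₁ V).hom ≫ compCellSq M.T q s (M.T.map p) e V) ≫
        (cell (M.muNat (M.T.map p)) V).hom := by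
    rw [mulCell_hom, mp_comp, Category.assoc,
      ← reassoc_of% (muNat_naturality M.toPseudomonadData s),
      muNat_comp, mp_comp, Category.assoc]
  have h3' := congrArg (mp (M.mu E)) h3
  have key' := congrArg (mp (M.mu E)) key
  simp only [mp_comp (M.mu E)] at h3' key'
  rw [mulCell_hom _ q s, mulCell_hom _ q s, reassoc_of% h3',
    ← reassoc_of% (cell_m_naturality M), cell_m_map, reassoc_of% key', Category.assoc]

end Pseudomonad

/-! ### The canonical left strength of a pseudomonad -/

section Canonical

variable (M : Pseudomonad Cat.{v, u})

/-- The data of the canonical left strength of a pseudomonad. -/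
def canonicalMonadStrengthData : MonadStrengthData M where
  toLeftStrength := canonicalStrength M.T
  w := canonicalW M
  z := canonicalZ M

/-- The canonical left strength of a pseudomonad. Each axiom is the corresponding general statement
about `μ` or `η`, applied to the functors `⟨a, -⟩`. The hypotheses on restricted 2-cells hold by
`HEq.rfl`, since the components of `x`, `y`, `w`, `z` and of the pseudonaturality of `t` at `(a, w)`
are by definition the components at `w` of the 2-cells prescribed for `⟨a, -⟩`. -/
def canonicalPseudomonadStrength : PseudomonadStrength M where
  toMonadStrengthData := canonicalMonadStrengthData M
  w_naturality {A A' B B'} f g a W :=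
    mulCell_square M.toPseudomonadData g (pair a B) (pair (ob f a) B') (tensHom f g)
      (pair a (M.T.obj B)) (canonicalSt M.T A B) (pair (ob f a) (M.T.obj B'))
      (canonicalSt M.T A' B') (tensHom f (M.T.map g)) (pair_natural f g a)
      (pair_canonicalSt M.T a B) (pair_canonicalSt M.T (ob f a) B')
      (pair_natural f (M.T.map g) a) (canonicalNat M.T f g)
      (fun _ => HEq.rfl) W _ (canonical_tmp_id M.T (ob f a) _)
  z_naturality {_ _ B B'} f g a b :=
    (congrArg _ (Category.id_comp _).symm).trans
      (etaNat_square M.toPseudomonadData g (pair (ob f a) B') (pair a B) (tensHom f g)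
        (pair_natural f g a) b _ (canonical_tmp_id M.T (ob f a) _))
  n_axiom {A B} a v :=
    (mulCell_n M (pair a B) (pair a (M.T.obj B)) (canonicalSt M.T A B) (pair_canonicalSt M.T a B) v
      _ (canonical_tmp_id M.T a _)).trans (congrArg _ (congrArg _ (Category.id_comp _)))
  p_axiom {A B} a v :=
    mulCell_p M (pair a B) (pair a (M.T.obj B)) (canonicalSt M.T A B) (pair_canonicalSt M.T a B)
      (tensHom (𝟙 A) (M.eta B)) (pair_natural (𝟙 A) (M.eta B) a) (canonicalZ M A B)
      (fun _ => HEq.rfl) v _ (canonical_tmp_id M.T a _)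
  m_axiom {A B} a V :=
    mulCell_m M (pair a B) (pair a (M.T.obj B)) (canonicalSt M.T A B) (pair_canonicalSt M.T a B)
      (pair a (M.T.obj (M.T.obj B))) (canonicalSt M.T A (M.T.obj B))
      (pair_canonicalSt M.T a (M.T.obj B)) (tensHom (𝟙 A) (M.mu B)) (pair_natural (𝟙 A) (M.mu B) a)
      (canonicalW M A B) (fun _ => HEq.rfl) V _ (canonical_tmp_id M.T a _)
  x_z_axiom {A} i a :=
    (congrArg _ (Category.comp_id _).symm).trans
      (etaNat_retract M.toPseudomonadData (pair i A) (lam A) rfl a)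
  x_w_axiom {A} i W :=
    mulCell_retract M.toPseudomonadData (pair i A) (lam A) (pair i (M.T.obj A))
      (canonicalSt M.T one A) (lam (M.T.obj A)) rfl (pair_canonicalSt M.T i A) rfl
      (canonicalX M.T A) (fun _ => HEq.rfl) W
  y_w_axiom {A B C} a b W :=
    mulCell_assoc M.toPseudomonadData (pair b C) (pair a (tens B C)) (pair (A := tens A B) (a, b) C)
      (assocHom A B C) rfl (pair b (M.T.obj C)) (canonicalSt M.T B C) (pair_canonicalSt M.T b C)
      (pair a (M.T.obj (tens B C))) (canonicalSt M.T A (tens B C))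
      (pair_canonicalSt M.T a (tens B C)) (pair (A := tens A B) (a, b) (M.T.obj C))
      (canonicalSt M.T (tens A B) C) (pair_canonicalSt M.T (A := tens A B) (a, b) C)
      (pair a (tens B (M.T.obj C))) (tensHom (𝟙 A) (canonicalSt M.T B C))
      (pair_natural (𝟙 A) (canonicalSt M.T B C) a) (assocHom A B (M.T.obj C)) rfl
      (canonicalY M.T A B C) (fun _ => HEq.rfl) W _ (canonical_tmp_id M.T a _)
  y_z_axiom {A B C} a b c :=
    (etaNat_inv_square M.toPseudomonadData (pair b C) (pair a (tens B C))
      (pair (A := tens A B) (a, b) C) (assocHom A B C) rfl c _ (canonical_tmp_id M.T a _)).trans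
      (congrArg _ (congrArg _ (Category.comp_id _)))

theorem comp_comp_id {C : Type u} [Category.{v} C] {X Y Z : C} (f : X ⟶ Y) (g : Y ⟶ Z) :
    f ≫ g = 𝟙 X ≫ f ≫ g ≫ 𝟙 Z := by
  rw [Category.id_comp, Category.comp_id]

theorem canonicalPseudomonadStrength_isCanonical :
    IsCanonicalMonad (canonicalPseudomonadStrength M).toMonadStrengthData where
  canonical := canonicalStrength_isCanonical M.T
  w_eq _ _ _ := comp_comp_id _ _
  z_eq _ _ := (Category.id_comp _).symm

end Canonical

end CatProd

theorem mainTheorem6 :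
    (∀ T : Cat.{v, u} ⥤ᵖ Cat.{v, u}, ∃ s : CatProd.LeftStrength T,
      CatProd.IsCanonical s.toStrengthData) ∧
    (∀ M : Pseudomonad Cat.{v, u}, ∃ s : CatProd.PseudomonadStrength M,
      CatProd.IsCanonicalMonad s.toMonadStrengthData) :=
  ⟨fun T => ⟨CatProd.canonicalStrength T, CatProd.canonicalStrength_isCanonical T⟩,
    fun M => ⟨CatProd.canonicalPseudomonadStrength M,
      CatProd.canonicalPseudomonadStrength_isCanonical M⟩⟩
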